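/- **Setting.** Let $\mathcal M=(\mathcal S,\mathcal A,\mathbb P,r,H,d_1)$ be an episodic MDP with arbitrary sets $\mathcal S,\mathcal A$, discrete laws $d_1$ and $\mathbb P_h(\cdot\mid s,a)$ on $\mathcal S$, and known deterministic rewards $r_h(s,a)\in[0,1]$, $h\in[H]$. Policies $\pi=(\pi_h(\cdot\mid s))$ are randomized and Markov (discrete laws on $\mathcal A$). $V^\pi_h(s)$ is the expected reward of $\pi$ collected at steps $h,\dots,H$ from $s$, $V^*_h=\sup_\pi V^\pi_h$ (with $V^*_{H+1}=0$), and $Q^*_h(s,a)=r_h(s,a)+\sum_{s'}\mathbb P_h(s'\mid s,a)V^*_{h+1}(s')$. The gap is $\Delta_h(s,a)=V_h^*(s)-Q_h^*(s,a)$, and $\Delta_{\min}=\inf\{\Delta_h(s,a):\Delta_h(s,a)\ne0\}$. $d^\pi_h(s)$ and $d^\pi_h(s,a)=d^\pi_h(s)\pi_h(a\mid s)$ are the visitation probabilities. A state $s$ is feasible at step $h$ if $d^\pi_h(s)>0$ for some $\pi$. $\mathcal M$ is a *linear mixture MDP*: there are known features $\phi(s'\mid s,a)\in\mathbb R^d$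 and unknown $w_h^*\in\mathbb R^d$ with $\|w_h^*\|_2\le C_w$ and $\mathbb P_h(s'\mid s,a)=\langle\phi(s'\mid s,a),w_h^*\rangle$, and $\phi_V(s,a):=\sum_{s'}\phi(s'\mid s,a)V(s')$ satisfies $\|\phi_V(s,a)\|_2\le1$ for all $V:\mathcal S\to[0,1]$. **Data.** $K$ episodes $(s^t_h,a^t_h)_{h\in[H]}$, $t\in[K]$, are generated by a behaviour $\mu$: episode $t$ is played in $\mathcal M$ with a Markov policy $\mu^t$ that may depend on the trajectories of all previous episodes, while the support $\operatorname{supp}\mu_h(\cdot\mid s)$ of $\mu^t_h(\cdot\mid s)$ depends neither on $t$ nor on the past and is known. (A fixed behaviour policy is a special case.) Let $\Pi(\mu)$ be the set of policies with $\operatorname{supp}\pi_h(\cdot\mid s)\subseteq\operatorname{supp}\mu_h(\cdot\mid s)$ for all $h$ and all states $s$ feasible at step $h$. **Algorithm (BCP-VTR).** For $k=1,\dots,K$: put $\hat V^k_{H+1}=0$ and, for $h=H,\dots,1$, with $\phi:=\phi_{\hat V^k_{h+1}}$ and $\lambda=1$, $$\Sigma_h^k=\lambda I+\sum_{t<k}\phi(s_h^t,a_h^t)\phi(s_h^t,a_h^t)^{\top},\qquad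 \hat w_h^k=(\Sigma_h^k)^{-1}\sum_{t<k}\phi(s_h^t,a_h^t)\hat V^k_{h+1}(s^t_{h+1}),$$ $$\hat Q_h^k=\max\bigl\{0,\min\{r_h+\langle\phi,\hat w_h^k\rangle-\beta_k\|\phi\|_{(\Sigma_h^k)^{-1}},\,H-h+1\}\bigr\},$$ let $\hat\pi^k\in\Pi(\mu)$ maximize $\langle\hat Q^k_h(s,\cdot),\pi_h(\cdot\mid s)\rangle$ over $\pi\in\Pi(\mu)$ for each $h$ and each state $s$ feasible at step $h$ (ties broken in any way that depends only on the first $k-1$ episodes), and put $\hat V^k_h(s)=\langle\hat Q^k_h(s,\cdot),\hat\pi^k_h(\cdot\mid s)\rangle$. Here $$\beta_k=H\sqrt{d\log\frac{H+kH^3/\lambda}{\delta}}+\sqrt\lambda\,C_w .$$ The mixture policy $\hat\pi^{mix}=\frac1K\sum_{k=1}^K\hat\pi^k$ draws $k\in[K]$ uniformly at the start of the episode and follows $\hat\pi^k$, so that $$\mathrm{SubOpt}(\hat\pi^{mix})=\mathbb E_{s\sim d_1}\Bigl[V_1^*(s)-\frac1K\sum_{k=1}^KV_1^{\hat\pi^k}(s)\Bigr].$$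 **Theorem.** For every $C_w$ there is a constant $C>0$, depending on $C_w$ only, such that the following holds for all linear mixture MDPs, behaviours, $K$ and $\delta$ as above. Assume 1. (optimal-policy concentrability) there is a policy $\pi^*\in\Pi(\mu)$ that is optimal, i.e. $V^{\pi^*}_h(s)=V^*_h(s)$ for all $h,s$, and $d_h^{\pi^*}(s,a)>0\Rightarrow d_h^\mu(s,a)>0$ for all $h,s,a$ and every possible $\mu^t$; 2. (density lower bound) $\kappa_h^{-1}:=\inf\{d^\mu_h(s,a): d^\mu_h(s,a)>0\}>0$ for all $h$, the infimum being also over all possible $\mu^t$; put $\kappa=\sum_{h=1}^H\kappa_h$; 3. $\Delta_{\min}>0$; 4. $\delta\in(0,1]$ and $K\kappa/\delta\ge2$. Then, with probability at least $1-(1+3\log_2(H/\Delta_{\min}))\delta$ over the data, $$\mathrm{SubOpt}(\hat\pi^{mix})\le C\cdot\frac{2d^2H^2\kappa^3}{\Delta_{\min}K}\log^3\Bigl(\frac{dKH}{\delta}\Bigr)+\frac{16\kappa}{3K}\log\log_2\Bigl(\frac{K\kappa}{\delta}\Bigr)+\frac2K .$$ -/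

import Mathlib

open scoped ENNReal

universe u v

noncomputable section

namespace OfflineRL

/-- An episodic time-inhomogeneous MDP with horizon `H`, discrete transition laws and known
deterministic rewards in `[0,1]`.  The states and actions form arbitrary types. Stages are
numbered `0, …, H - 1` (stage `h` is step `h + 1` in one-based numbering); the data at indices
`h ≥ H` are never used. -/
structure EpisodicMDP (S : Type u) (A : Type v) where
  H : ℕ
  init : PMF S
  P : ℕ → S → A → PMF S
  r : ℕ → S → A → ℝ
  r_mem : ∀ h s a, r h s a ∈ Set.Icc (0 : ℝ) 1

/-- A (randomized, Markov) policy: an action distribution for every stage and state. -/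
abbrev Policy (S : Type u) (A : Type v) : Type (max u v) := ℕ → S → PMF A

section Values

variable {S : Type u} {A : Type v} (M : EpisodicMDP S A)

/-- `(P_h V)(s,a)`, the expectation of `V` at the next state. -/
def EpisodicMDP.nextExp (h : ℕ) (V : S → ℝ) (s : S) (a : A) : ℝ :=
  ∑' s', (M.P h s a s').toReal * V s'

/-- `⟨f, ν⟩`, the expectation of `f` under the action distribution `ν`. -/
def actionExp (ν : PMF A) (f : A → ℝ) : ℝ := ∑' a, (ν a).toReal * f a

/-- Expected total reward of `π` over the `n` stages `h, h + 1, …, h + n - 1` from state `s`. -/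
def EpisodicMDP.returnAux (π : Policy S A) : ℕ → ℕ → S → ℝ
  | 0, _, _ => 0
  | n + 1, h, s =>
      actionExp (π h s) fun a =>
        M.r h s a + M.nextExp h (EpisodicMDP.returnAux π n (h + 1)) s a

/-- `V^π_h(s)`: the expected total reward of `π` collected at the stages `h, …, H - 1`. -/
def EpisodicMDP.value (π : Policy S A) (h : ℕ) (s : S) : ℝ := M.returnAux π (M.H - h) h s

/-- `V^*_h(s)`. -/
def EpisodicMDP.optValue (h : ℕ) (s : S) : ℝ := ⨆ π : Policy S A, M.value π h s

/-- `Q^*_h(s,a)`. -/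
def EpisodicMDP.optQ (h : ℕ) (s : S) (a : A) : ℝ :=
  M.r h s a + M.nextExp h (M.optValue (h + 1)) s a

/-- `π` is an optimal policy: it attains the optimal value at every stage and state. -/
def EpisodicMDP.IsOptimal (π : Policy S A) : Prop :=
  ∀ h < M.H, ∀ s, M.value π h s = M.optValue h s

/-- The sub-optimality gap `Δ_h(s,a) = V^*_h(s) - Q^*_h(s,a)`. -/
def EpisodicMDP.gap (h : ℕ) (s : S) (a : A) : ℝ := M.optValue h s - M.optQ h s a

/-- The minimal nonzero gap `Δ_min` (over all stages, states and actions). -/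
def EpisodicMDP.gapMin : ℝ :=
  sInf {x : ℝ | ∃ h < M.H, ∃ (s : S) (a : A), x = M.gap h s a ∧ x ≠ 0}

/-- The state visitation law `d^π_h` at stage `h`. -/
def EpisodicMDP.stateOcc (π : Policy S A) : ℕ → PMF S
  | 0 => M.init
  | h + 1 => (EpisodicMDP.stateOcc π h).bind fun s => (π h s).bind fun a => M.P h s a

/-- The state-action visitation probability `d^π_h(s,a) = d^π_h(s) π_h(a|s)`. -/
def EpisodicMDP.occ (π : Policy S A) (h : ℕ) (s : S) (a : A) : ℝ≥0∞ :=
  M.stateOcc π h s * π h s a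

/-- `s` is a feasible state at stage `h`, that is, some policy reaches it with positive
probability. -/
def EpisodicMDP.Feasible (h : ℕ) (s : S) : Prop := ∃ π : Policy S A, M.stateOcc π h s ≠ 0

/-- The sub-optimality of the mixture `(1/K) ∑_k π^k`, the policy which draws an index `k`
uniformly from the `K` indices at the start of the episode and then follows `π^k`:
`E_{s ~ init}[V^*_1(s) - (1/K) ∑_k V_1^{π^k}(s)]`. -/
def EpisodicMDP.subOptMix {K : ℕ} (π : Fin K → Policy S A) : ℝ :=
  ∑' s, (M.init s).toReal * (M.optValue 0 s - (1 / (K : ℝ)) * ∑ k, M.value (π k) 0 s)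

end Values

section Data

variable {S : Type u} {A : Type v} (M : EpisodicMDP S A)

/-- The trajectory `(s_1, a_1, …, s_H, a_H)` of one episode. (The rewards are a known function
of it.) -/
abbrev EpisodicMDP.Traj : Type (max u v) := Fin M.H → S × A

/-- Law of the state following a partial trajectory of `n` state-action pairs. -/
def EpisodicMDP.nextState : (n : ℕ) → (Fin n → S × A) → PMF S
  | 0, _ => M.init
  | n + 1, τ => M.P n (τ (Fin.last n)).1 (τ (Fin.last n)).2

/-- Law of the first `n` state-action pairs of an episode played with the policy `π`. -/
def EpisodicMDP.trajLaw (π : Policy S A) : (n : ℕ) → PMF (Fin n → S × A)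
  | 0 => PMF.pure Fin.elim0
  | n + 1 =>
      (EpisodicMDP.trajLaw π n).bind fun τ =>
        (M.nextState n τ).bind fun s =>
          (π n s).map fun a => Fin.snoc (α := fun _ => S × A) τ (s, a)

/-- An adaptive behaviour `μ`: the policy that is used in the next episode may depend on the
trajectories of all `k` previous episodes, while its support `supp(μ_h(·|s))`, which is known
to the learner, does not. A fixed behaviour policy is the case of a constant `policy`. -/
structure Behaviour where
  policy : (k : ℕ) → (Fin k → M.Traj) → Policy S A
  supp : ℕ → S → Set A
  support_eq : ∀ k D h s, (policy k D h s).support = supp h s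

variable {M}

/-- The law of the data set made of the trajectories of the first `k` episodes. -/
def Behaviour.dataLaw (μ : Behaviour M) : (k : ℕ) → PMF (Fin k → M.Traj)
  | 0 => PMF.pure Fin.elim0
  | k + 1 =>
      (Behaviour.dataLaw μ k).bind fun D =>
        (M.trajLaw (μ.policy k D) M.H).map fun τ => Fin.snoc (α := fun _ => M.Traj) D τ

/-- `π_h` belongs to the `μ`-supported class `Π_h(μ)` for every stage `h`. -/
def Behaviour.Supports (μ : Behaviour M) (π : Policy S A) : Prop :=
  ∀ h < M.H, ∀ s, M.Feasible h s → (π h s).support ⊆ μ.supp h s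

/-- Optimal-policy concentrability with respect to the (optimal) policy `π`: wherever
`d^π_h(s,a) > 0`, also `d^μ_h(s,a) > 0`. -/
def Behaviour.Covers (μ : Behaviour M) (π : Policy S A) : Prop :=
  ∀ h < M.H, ∀ s a, M.occ π h s a ≠ 0 → ∀ k D, M.occ (μ.policy k D) h s a ≠ 0

/-- `κ_h⁻¹`, the infimum of the positive visitation probabilities under `μ` at stage `h`. -/
def Behaviour.densityInf (μ : Behaviour M) (h : ℕ) : ℝ :=
  sInf {x : ℝ | ∃ k D s a, x = (M.occ (μ.policy k D) h s a).toReal ∧ 0 < x}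

/-- `κ = ∑_h κ_h`. -/
def Behaviour.kappa (μ : Behaviour M) : ℝ := ∑ h ∈ Finset.range M.H, (μ.densityInf h)⁻¹

end Data

section LinearMixture

variable {S : Type u} {A : Type v} {d : ℕ}

/-- `φ_V(s,a) = ∑_{s'} φ(s'|s,a) V(s')`; the feature `φ(s'|s,a)` is written `φ s a s'`. -/
def phiV (φ : S → A → S → EuclideanSpace ℝ (Fin d)) (V : S → ℝ) (s : S) (a : A) :
    EuclideanSpace ℝ (Fin d) :=
  ∑' s', V s' • φ s a s'

/-- `M` is a linear mixture MDP with features `φ` and parameter norm bound `Cw`. (The last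
condition, applied to indicators of finite sets, makes `φ(·|s,a)` summable.) -/
structure IsLinearMixture (M : EpisodicMDP S A) (φ : S → A → S → EuclideanSpace ℝ (Fin d))
    (Cw : ℝ) : Prop where
  transition : ∃ w : ℕ → EuclideanSpace ℝ (Fin d), ∀ h < M.H,
    ‖w h‖ ≤ Cw ∧ ∀ s a s', (M.P h s a s').toReal = inner ℝ (φ s a s') (w h)
  norm_phiV_le : ∀ V : S → ℝ, (∀ s, V s ∈ Set.Icc (0 : ℝ) 1) → ∀ s a, ‖phiV φ V s a‖ ≤ 1

/-- `x ↦ ‖x‖_{Σ⁻¹} = √(xᵀ Σ⁻¹ x)`. -/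
def invNorm (Sig : Matrix (Fin d) (Fin d) ℝ) (x : EuclideanSpace ℝ (Fin d)) : ℝ :=
  √(x.ofLp ⬝ᵥ (Sig⁻¹).mulVec x.ofLp)

end LinearMixture

section Algorithm

variable {S : Type u} {A : Type v} {d : ℕ} {M : EpisodicMDP S A}

/-- The regularized Gram matrix `Σ_h = ∑_t φ_V(s_h^t,a_h^t) φ_V(s_h^t,a_h^t)ᵀ + lam I`. -/
def gram (φ : S → A → S → EuclideanSpace ℝ (Fin d)) (lam : ℝ) {n : ℕ} (D : Fin n → M.Traj)
    (h : Fin M.H) (V : S → ℝ) : Matrix (Fin d) (Fin d) ℝ :=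
  ∑ t, Matrix.vecMulVec (phiV φ V (D t h).1 (D t h).2).ofLp
      (phiV φ V (D t h).1 (D t h).2).ofLp
    + lam • (1 : Matrix (Fin d) (Fin d) ℝ)

/-- The regression target `V(s_{h+1}^t)`. At the last stage, the value function of the following
stage vanishes identically, and so does the target. -/
def target {n : ℕ} (D : Fin n → M.Traj) (h : Fin M.H) (V : S → ℝ) (t : Fin n) : ℝ :=
  if hh : (h : ℕ) + 1 < M.H then V (D t ⟨(h : ℕ) + 1, hh⟩).1 else 0

/-- The ridge estimate `ŵ_h = Σ_h⁻¹ ∑_t φ_V(s_h^t,a_h^t) V(s_{h+1}^t)`. -/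
def ridge (φ : S → A → S → EuclideanSpace ℝ (Fin d)) (lam : ℝ) {n : ℕ} (D : Fin n → M.Traj)
    (h : Fin M.H) (V : S → ℝ) : Fin d → ℝ :=
  ((gram φ lam D h V)⁻¹).mulVec
    (∑ t, target D h V t • (phiV φ V (D t h).1 (D t h).2).ofLp)

/-- The pessimistic action value
`Q̂_h = min{r_h + ⟨φ_V, ŵ_h⟩ - b ‖φ_V‖_{Σ_h⁻¹}, number of remaining stages}^+`, where `V` is the
estimated value function of the following stage. -/
def qHat (φ : S → A → S → EuclideanSpace ℝ (Fin d)) (lam b : ℝ) {n : ℕ} (D : Fin n → M.Traj)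
    (h : Fin M.H) (V : S → ℝ) (s : S) (a : A) : ℝ :=
  max 0 (min
    (M.r h s a + (phiV φ V s a).ofLp ⬝ᵥ ridge φ lam D h V
      - b * invNorm (gram φ lam D h V) (phiV φ V s a))
    ((M.H : ℝ) - (h : ℕ)))

/-- `π` is the policy which one iteration of the outer loop of BCP-VTR (bootstrapped and
constrained pessimistic value-targeted regression) computes from the episodes `D`, with
regularization `lam` and uncertainty parameter `b`; the estimates `V̂_h` are the functions `V h`.
Ties in the greedy step may be broken in any way. -/
def IsBCPVTROutput (μ : Behaviour M) (φ : S → A → S → EuclideanSpace ℝ (Fin d)) (lam b : ℝ)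
    {n : ℕ} (D : Fin n → M.Traj) (π : Policy S A) : Prop :=
  μ.Supports π ∧
  ∃ V : ℕ → S → ℝ,
    (∀ s, V M.H s = 0) ∧
    ∀ h : Fin M.H,
      (∀ s, M.Feasible h s → ∀ ν : PMF A, ν.support ⊆ μ.supp h s →
        actionExp ν (qHat φ lam b D h (V (h + 1)) s)
          ≤ actionExp (π h s) (qHat φ lam b D h (V (h + 1)) s)) ∧
      ∀ s, V h s = actionExp (π h s) (qHat φ lam b D h (V (h + 1)) s)

/-- `β_k = H √(d log((H + k H³ / lam) / δ)) + √lam C_w`. -/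
def betaVTR (H d : ℕ) (lam Cw δ : ℝ) (k : ℕ) : ℝ :=
  H * √(d * Real.log ((H + k * (H : ℝ) ^ 3 / lam) / δ)) + √lam * Cw

/-- The first `k` of `K` episodes. -/
def firstEpisodes {K : ℕ} (D : Fin K → M.Traj) (k : Fin K) : Fin (k : ℕ) → M.Traj :=
  fun i => D (Fin.castLE k.isLt.le i)

end Algorithm

end OfflineRL

end

/-! The density lower bound makes the visited part of the MDP finite: at stage `h` the behaviour
visits at most `κ_h` pairs, always the same ones because its supports are fixed. Policies in the
supported class never leave these pairs, so only accuracy there matters.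

Let `L = log(2κK²/δ)`. Once `n ≥ 4Lκ` episodes are available, typical data contain each such pair at
least `n / (4 κ_h)` times. A union bound over all subsets of the finite set of next states controls
the transitions for all value functions at once, which disposes of the dependence of the
bootstrapped estimates on the data (`measure_not_concentrated_le`, `Concentrated.abs_deviation_le`).
Grouping the residuals of the ridge regression by pairs then bounds the one-step error at stage `h`
by `2 κ_h E / √n`, where `E` is `errorConst` (`ridgeGram_inv_le_of_visits`, `abs_ridge_error_le`,
`Concentrated.abs_qHat_sub_le`). The pessimistic penalty enters only as one more error term.

Let `e = 2κE/√n` be the sum of these errors. By backward induction the estimated values are within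
`e` of the optimal values and of the values of the greedy policy, and each action which the greedy
policy plays has gap at most `2e` (`IsApproxGreedy.gap_le`). If `2e < Δ_min`, the policy is
therefore exactly optimal on the visited states; otherwise its loss is at most `2e ≤ (2e)²/Δ_min`
(`IsApproxGreedy.optValue_sub_value_le`). The square turns the rate `1/√n` into `1/n`, whose sum
over the iterations is logarithmic. The iterations before the burn-in cost at most `H` each, and
`E²` is of order `H²κd log(dKH/δ)`, whence the factor `κ³`. The failure probability is `δ`; the
iterated logarithm and the logarithm in the probability are nonnegative slack. -/

noncomputable section

namespace OfflineRL

/-! ### Expectations under discrete laws -/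

section Expectation

variable {α : Type*} {β : Type*}

/-- Expectation of an extended nonnegative function under a discrete law. -/
def lexp (p : PMF α) (f : α → ℝ≥0∞) : ℝ≥0∞ := ∑' x, p x * f x

lemma lexp_mono {p : PMF α} {f g : α → ℝ≥0∞} (h : ∀ x, p x ≠ 0 → f x ≤ g x) :
    lexp p f ≤ lexp p g := by
  refine ENNReal.tsum_le_tsum fun x => ?_
  by_cases hx : p x = 0
  · simp [hx]
  · gcongr
    exact h x hx

lemma lexp_congr {p : PMF α} {f g : α → ℝ≥0∞} (h : ∀ x, p x ≠ 0 → f x = g x) :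
    lexp p f = lexp p g :=
  le_antisymm (lexp_mono fun x hx => (h x hx).le) (lexp_mono fun x hx => (h x hx).ge)

lemma lexp_const (p : PMF α) (c : ℝ≥0∞) : lexp p (fun _ => c) = c := by
  simp [lexp, ENNReal.tsum_mul_right, p.tsum_coe]

lemma lexp_const_mul (p : PMF α) (c : ℝ≥0∞) (f : α → ℝ≥0∞) :
    lexp p (fun x => c * f x) = c * lexp p f := by
  simp only [lexp, ← ENNReal.tsum_mul_left]
  exact tsum_congr fun x => by ring

lemma lexp_add (p : PMF α) (f g : α → ℝ≥0∞) :
    lexp p (fun x => f x + g x) = lexp p f + lexp p g := by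
  simp only [lexp, mul_add]
  exact ENNReal.tsum_add

lemma lexp_pure (a : α) (f : α → ℝ≥0∞) : lexp (PMF.pure a) f = f a := by
  rw [lexp, tsum_eq_single a]
  · simp
  · intro b hb
    simp [PMF.pure_apply, hb]

lemma lexp_bind (p : PMF α) (q : α → PMF β) (f : β → ℝ≥0∞) :
    lexp (p.bind q) f = lexp p fun x => lexp (q x) f := by
  simp only [lexp, PMF.bind_apply, ← ENNReal.tsum_mul_right, ← ENNReal.tsum_mul_left]
  rw [ENNReal.tsum_comm]
  exact tsum_congr fun x => tsum_congr fun y => by ring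

lemma lexp_map (p : PMF α) (g : α → β) (f : β → ℝ≥0∞) :
    lexp (p.map g) f = lexp p fun x => f (g x) := by
  rw [← PMF.bind_pure_comp, lexp_bind]
  simp [lexp_pure]

/-- Markov's inequality. -/
lemma toOuterMeasure_le_lexp_div (p : PMF α) (f : α → ℝ≥0∞) (s : Set α) {c : ℝ≥0∞}
    (hc0 : c ≠ 0) (hc : c ≠ ∞) (hs : ∀ x ∈ s, p x ≠ 0 → c ≤ f x) :
    p.toOuterMeasure s ≤ lexp p f / c := by
  rw [ENNReal.le_div_iff_mul_le (Or.inl hc0) (Or.inl hc), PMF.toOuterMeasure_apply,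
    ← ENNReal.tsum_mul_right]
  refine ENNReal.tsum_le_tsum fun x => ?_
  by_cases hx : x ∈ s
  · rw [Set.indicator_of_mem hx]
    by_cases h0 : p x = 0
    · simp [h0]
    · gcongr
      exact hs x hx h0
  · simp [hx]

lemma le_toOuterMeasure_of_compl_le (p : PMF α) (s : Set α) {c : ℝ≥0∞}
    (h : p.toOuterMeasure sᶜ ≤ c) : 1 - c ≤ p.toOuterMeasure s := by
  have h1 : p.toOuterMeasure s + p.toOuterMeasure sᶜ = 1 := by
    simp only [PMF.toOuterMeasure_apply]
    rw [← ENNReal.tsum_add, ← p.tsum_coe]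
    exact tsum_congr fun x => congrFun (Set.indicator_self_add_compl s p) x
  rw [tsub_le_iff_right, ← h1]
  gcongr

lemma summable_pmf_mul (p : PMF α) {f : α → ℝ} {C : ℝ} (hf : ∀ x, |f x| ≤ C) :
    Summable fun x => (p x).toReal * f x := by
  have hs : Summable fun x => (p x).toReal := ENNReal.summable_toReal p.tsum_coe_ne_top
  refine Summable.of_norm_bounded (hs.mul_right C) fun x => ?_
  rw [Real.norm_eq_abs, abs_mul, abs_of_nonneg ENNReal.toReal_nonneg]
  exact mul_le_mul_of_nonneg_left (hf x) ENNReal.toReal_nonneg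

lemma actionExp_const (p : PMF α) (c : ℝ) : actionExp p (fun _ => c) = c := by
  simp only [actionExp, tsum_mul_right]
  rw [← ENNReal.tsum_toReal_eq fun x => p.apply_ne_top x, p.tsum_coe]
  simp

lemma actionExp_congr {p : PMF α} {f g : α → ℝ} (h : ∀ x, p x ≠ 0 → f x = g x) :
    actionExp p f = actionExp p g := by
  refine tsum_congr fun x => ?_
  by_cases hx : p x = 0
  · simp [hx]
  · rw [h x hx]

lemma actionExp_mono {p : PMF α} {f g : α → ℝ} {C C' : ℝ} (hf : ∀ x, |f x| ≤ C)
    (hg : ∀ x, |g x| ≤ C') (h : ∀ x, p x ≠ 0 → f x ≤ g x) :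
    actionExp p f ≤ actionExp p g := by
  refine (summable_pmf_mul p hf).tsum_le_tsum (fun x => ?_) (summable_pmf_mul p hg)
  by_cases hx : p x = 0
  · simp [hx]
  · exact mul_le_mul_of_nonneg_left (h x hx) ENNReal.toReal_nonneg

lemma actionExp_add {p : PMF α} {f g : α → ℝ} {C C' : ℝ} (hf : ∀ x, |f x| ≤ C)
    (hg : ∀ x, |g x| ≤ C') :
    actionExp p (fun x => f x + g x) = actionExp p f + actionExp p g := by
  simp only [actionExp, mul_add]
  exact (summable_pmf_mul p hf).tsum_add (summable_pmf_mul p hg)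

lemma actionExp_const_mul (p : PMF α) (c : ℝ) (f : α → ℝ) :
    actionExp p (fun x => c * f x) = c * actionExp p f := by
  simp only [actionExp, ← tsum_mul_left]
  exact tsum_congr fun x => by ring

lemma actionExp_sub {p : PMF α} {f g : α → ℝ} {C C' : ℝ} (hf : ∀ x, |f x| ≤ C)
    (hg : ∀ x, |g x| ≤ C') :
    actionExp p (fun x => f x - g x) = actionExp p f - actionExp p g := by
  simp only [actionExp, mul_sub]
  exact (summable_pmf_mul p hf).tsum_sub (summable_pmf_mul p hg)

lemma actionExp_le_of_le {p : PMF α} {f : α → ℝ} {C c : ℝ} (hf : ∀ x, |f x| ≤ C)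
    (h : ∀ x, p x ≠ 0 → f x ≤ c) : actionExp p f ≤ c := by
  rw [← actionExp_const p c]
  exact actionExp_mono hf (fun _ => le_rfl) h

lemma le_actionExp_of_le {p : PMF α} {f : α → ℝ} {C c : ℝ} (hf : ∀ x, |f x| ≤ C)
    (h : ∀ x, p x ≠ 0 → c ≤ f x) : c ≤ actionExp p f := by
  rw [← actionExp_const p c]
  exact actionExp_mono (fun _ => le_rfl) hf h

lemma actionExp_pure (a : α) (f : α → ℝ) : actionExp (PMF.pure a) f = f a := by
  rw [actionExp, tsum_eq_single a]
  · simp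
  · intro b hb
    simp [PMF.pure_apply, hb]

lemma abs_actionExp_sub_le {p : PMF α} {f g : α → ℝ} {C C' c : ℝ} (hf : ∀ x, |f x| ≤ C)
    (hg : ∀ x, |g x| ≤ C') (h : ∀ x, p x ≠ 0 → |f x - g x| ≤ c) :
    |actionExp p f - actionExp p g| ≤ c := by
  rw [← actionExp_sub hf hg]
  have hb : ∀ x, |f x - g x| ≤ C + C' := fun x =>
    (abs_sub _ _).trans (add_le_add (hf x) (hg x))
  exact abs_le.2 ⟨le_actionExp_of_le hb fun x hx => (abs_le.1 (h x hx)).1,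
    actionExp_le_of_le hb fun x hx => (abs_le.1 (h x hx)).2⟩

/-- A function which is at most its own expectation is constant on the support. -/
lemma eq_actionExp_of_le {p : PMF α} {f : α → ℝ} {C : ℝ} (hf : ∀ x, |f x| ≤ C)
    (h : ∀ x, p x ≠ 0 → f x ≤ actionExp p f) {a : α} (ha : p a ≠ 0) :
    f a = actionExp p f := by
  set m := actionExp p f with hm
  have hb : ∀ x, |m - f x| ≤ |m| + C := fun x =>
    (abs_sub _ _).trans (add_le_add le_rfl (hf x))
  have hz : actionExp p (fun x => m - f x) = 0 := by
    rw [actionExp_sub (fun _ => le_rfl) hf, actionExp_const, ← hm, sub_self]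
  have hnn : ∀ x, 0 ≤ (p x).toReal * (m - f x) := fun x => by
    by_cases hx : p x = 0
    · simp [hx]
    · exact mul_nonneg ENNReal.toReal_nonneg (sub_nonneg.2 (h x hx))
  have hsum := (summable_pmf_mul p hb).hasSum
  rw [show ∑' x, (p x).toReal * (m - f x) = 0 from hz] at hsum
  have h1 := (hasSum_zero_iff_of_nonneg hnn).1 hsum
  have h2 := congrFun h1 a
  simp only [Pi.zero_apply, mul_eq_zero] at h2
  rcases h2 with h2 | h2
  · exact absurd ((ENNReal.toReal_eq_zero_iff _).1 h2) (by simp [ha, p.apply_ne_top a])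
  · linarith

/-- Real and extended expectations agree. -/
lemma lexp_ofReal {p : PMF α} {f : α → ℝ} {C : ℝ} (hf : ∀ x, |f x| ≤ C) (h0 : ∀ x, 0 ≤ f x) :
    lexp p (fun x => ENNReal.ofReal (f x)) = ENNReal.ofReal (actionExp p f) := by
  rw [actionExp, ENNReal.ofReal_tsum_of_nonneg
    (fun x => mul_nonneg ENNReal.toReal_nonneg (h0 x)) (summable_pmf_mul p hf)]
  refine tsum_congr fun x => ?_
  rw [ENNReal.ofReal_mul ENNReal.toReal_nonneg, ENNReal.ofReal_toReal (p.apply_ne_top x)]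

/-- Exponential moment of a centred variable with values in `[-1, 1]`. -/
lemma actionExp_exp_le {p : PMF α} {f : α → ℝ} (hf : ∀ x, |f x| ≤ 1) (h0 : actionExp p f = 0)
    (l : ℝ) : actionExp p (fun x => Real.exp (l * f x)) ≤ Real.exp (l ^ 2 / 2) := by
  -- Convexity puts `exp` below its chord between `-l` and `l`. The chord is affine in `f x`, so for
  -- centred `f` its mean is `cosh l`.
  have hpt : ∀ x, Real.exp (l * f x) ≤ Real.cosh l + Real.sinh l * f x := by
    intro x
    obtain ⟨h1, h2⟩ := abs_le.1 (hf x)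
    have := (convexOn_exp).2 (Set.mem_univ l) (Set.mem_univ (-l))
      (show 0 ≤ (1 + f x) / 2 by linarith) (show 0 ≤ (1 - f x) / 2 by linarith) (by ring)
    simp only [smul_eq_mul] at this
    rw [Real.cosh_eq, Real.sinh_eq]
    have e : (1 + f x) / 2 * l + (1 - f x) / 2 * -l = l * f x := by ring
    rw [e] at this
    linarith
  have hs : ∀ x, |Real.sinh l * f x| ≤ |Real.sinh l| := fun x => by
    rw [abs_mul]
    exact mul_le_of_le_one_right (abs_nonneg _) (hf x)
  have he : ∀ x, |Real.exp (l * f x)| ≤ |Real.cosh l| + |Real.sinh l| := fun x => by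
    rw [abs_of_pos (Real.exp_pos _)]
    exact (hpt x).trans (add_le_add (le_abs_self _) ((le_abs_self _).trans (hs x)))
  calc actionExp p (fun x => Real.exp (l * f x))
      ≤ actionExp p (fun x => Real.cosh l + Real.sinh l * f x) :=
        actionExp_mono he (fun x => (abs_add_le _ _).trans (add_le_add le_rfl (hs x)))
          fun x _ => hpt x
    _ = Real.cosh l := by
        rw [actionExp_add (fun _ => le_rfl) hs, actionExp_const, actionExp_const_mul, h0]
        ring
    _ ≤ Real.exp (l ^ 2 / 2) := Real.cosh_le_exp_half_sq l

end Expectation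

/-! ### Optimal values and gaps -/

section OptimalValues

variable {S : Type u} {A : Type v} {M : EpisodicMDP S A}

lemma abs_le_of_mem_zero_le {x c : ℝ} (h0 : 0 ≤ x) (h1 : x ≤ c) : |x| ≤ c := by
  rwa [abs_of_nonneg h0]

lemma backup_mem {h : ℕ} {V : S → ℝ} {c : ℝ} (hV : ∀ s, V s ∈ Set.Icc 0 c) (s : S) (a : A) :
    M.r h s a + M.nextExp h V s a ∈ Set.Icc 0 (c + 1) := by
  have hb : ∀ s, |V s| ≤ c := fun s => abs_le_of_mem_zero_le (hV s).1 (hV s).2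
  have h1 : 0 ≤ actionExp (M.P h s a) V := le_actionExp_of_le hb fun x _ => (hV x).1
  have h2 : actionExp (M.P h s a) V ≤ c := actionExp_le_of_le hb fun x _ => (hV x).2
  have h3 := M.r_mem h s a
  exact ⟨add_nonneg h3.1 h1, (add_le_add h3.2 h2).trans (by rw [add_comm])⟩

lemma returnAux_mem (π : Policy S A) (n h : ℕ) (s : S) :
    M.returnAux π n h s ∈ Set.Icc (0 : ℝ) n := by
  induction n generalizing h s with
  | zero => simp [EpisodicMDP.returnAux]
  | succ n ih =>
    have hb := fun a => backup_mem (M := M) (h := h) (ih (h + 1)) s a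
    rw [EpisodicMDP.returnAux]
    push_cast
    exact ⟨le_actionExp_of_le (fun a => abs_le_of_mem_zero_le (hb a).1 (hb a).2)
      fun a _ => (hb a).1,
      actionExp_le_of_le (fun a => abs_le_of_mem_zero_le (hb a).1 (hb a).2) fun a _ => (hb a).2⟩

lemma returnAux_congr {π π' : Policy S A} (n h : ℕ) (hπ : ∀ h', h ≤ h' → π h' = π' h') :
    M.returnAux π n h = M.returnAux π' n h := by
  induction n generalizing h with
  | zero => rfl
  | succ n ih =>
    funext s
    rw [EpisodicMDP.returnAux, EpisodicMDP.returnAux, hπ h le_rfl,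
      ih (h + 1) fun h' hh => hπ h' (by omega)]

lemma value_horizon (π : Policy S A) (s : S) : M.value π M.H s = 0 := by
  simp [EpisodicMDP.value, EpisodicMDP.returnAux]

lemma value_succ (π : Policy S A) {h : ℕ} (hh : h < M.H) (s : S) :
    M.value π h s
      = actionExp (π h s) fun a => M.r h s a + M.nextExp h (M.value π (h + 1)) s a := by
  have e : M.H - h = (M.H - (h + 1)) + 1 := by omega
  rw [EpisodicMDP.value, e, EpisodicMDP.returnAux]
  rfl

lemma value_mem (π : Policy S A) (h : ℕ) (s : S) :
    M.value π h s ∈ Set.Icc (0 : ℝ) ((M.H - h : ℕ) : ℝ) :=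
  returnAux_mem π _ h s

lemma value_le_horizon (π : Policy S A) (h : ℕ) (s : S) : M.value π h s ≤ M.H :=
  (value_mem π h s).2.trans (by exact_mod_cast Nat.sub_le _ _)

lemma abs_value_le (π : Policy S A) (h : ℕ) (s : S) : |M.value π h s| ≤ M.H :=
  abs_le_of_mem_zero_le (value_mem π h s).1 (value_le_horizon π h s)

lemma value_le_optValue (π : Policy S A) (h : ℕ) (s : S) : M.value π h s ≤ M.optValue h s :=
  le_ciSup (f := fun π : Policy S A => M.value π h s)
    ⟨M.H, by rintro _ ⟨π, rfl⟩; exact value_le_horizon π h s⟩ π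

variable {πs : Policy S A}

lemma optValue_eq (hs : M.IsOptimal πs) {h : ℕ} (hh : h ≤ M.H) :
    M.optValue h = M.value πs h := by
  funext s
  rcases hh.lt_or_eq with h1 | rfl
  · exact (hs h h1 s).symm
  · have : Nonempty (Policy S A) := ⟨πs⟩
    rw [EpisodicMDP.optValue]
    simp [value_horizon]

lemma optQ_eq (hs : M.IsOptimal πs) {h : ℕ} (hh : h < M.H) (s : S) (a : A) :
    M.optQ h s a = M.r h s a + M.nextExp h (M.value πs (h + 1)) s a := by
  rw [EpisodicMDP.optQ, optValue_eq hs hh]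

lemma optQ_mem (hs : M.IsOptimal πs) {h : ℕ} (hh : h < M.H) (s : S) (a : A) :
    M.optQ h s a ∈ Set.Icc (0 : ℝ) M.H := by
  rw [optQ_eq hs hh]
  have h1 := backup_mem (M := M) (h := h) (value_mem (M := M) πs (h + 1)) s a
  refine ⟨h1.1, h1.2.trans ?_⟩
  have : M.H - (h + 1) + 1 ≤ M.H := by omega
  exact_mod_cast this

lemma abs_optQ_le (hs : M.IsOptimal πs) {h : ℕ} (hh : h < M.H) (s : S) (a : A) :
    |M.optQ h s a| ≤ M.H :=
  abs_le_of_mem_zero_le (optQ_mem hs hh s a).1 (optQ_mem hs hh s a).2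

lemma optValue_bellman (hs : M.IsOptimal πs) {h : ℕ} (hh : h < M.H) (s : S) :
    M.optValue h s = actionExp (πs h s) (M.optQ h s) := by
  rw [optValue_eq hs hh.le, value_succ πs hh]
  exact actionExp_congr fun a _ => (optQ_eq hs hh s a).symm

/-- Playing `a` once and following `πs` afterwards is a competitor in the supremum. -/
lemma optQ_le_optValue (hs : M.IsOptimal πs) {h : ℕ} (hh : h < M.H) (s : S) (a : A) :
    M.optQ h s a ≤ M.optValue h s := by
  classical
  set π' : Policy S A := fun h' s' => if h' = h then PMF.pure a else πs h' s' with hπ'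
  refine le_trans (le_of_eq ?_) (value_le_optValue π' h s)
  have e : M.value π' (h + 1) = M.value πs (h + 1) :=
    returnAux_congr _ _ fun h' hle => by
      funext s'
      simp [hπ', show h' ≠ h by omega]
  rw [value_succ π' hh, e, optQ_eq hs hh]
  simp [hπ', actionExp_pure]

lemma gap_nonneg (hs : M.IsOptimal πs) {h : ℕ} (hh : h < M.H) (s : S) (a : A) :
    0 ≤ M.gap h s a :=
  sub_nonneg.2 (optQ_le_optValue hs hh s a)

lemma gapMin_le_gap (hs : M.IsOptimal πs) {h : ℕ} (hh : h < M.H) {s : S} {a : A}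
    (hg : M.gap h s a ≠ 0) : M.gapMin ≤ M.gap h s a :=
  csInf_le ⟨0, by rintro _ ⟨h, hh, s, a, rfl, -⟩; exact gap_nonneg hs hh s a⟩
    ⟨h, hh, s, a, rfl, hg⟩

/-- Makes `log₂(H/Δ_min)` nonnegative and gives `H ≤ H²/Δ_min`. The set of nonzero gaps is nonempty
because `sInf ∅ = 0`. -/
lemma gapMin_le_horizon (hs : M.IsOptimal πs) (hpos : 0 < M.gapMin) : M.gapMin ≤ M.H := by
  have hne : {x : ℝ | ∃ h < M.H, ∃ (s : S) (a : A), x = M.gap h s a ∧ x ≠ 0}.Nonempty := by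
    by_contra hne
    rw [Set.not_nonempty_iff_eq_empty] at hne
    rw [EpisodicMDP.gapMin, hne, Real.sInf_empty] at hpos
    exact lt_irrefl _ hpos
  obtain ⟨x, h, hh, s, a, rfl, hx⟩ := hne
  refine (gapMin_le_gap hs hh hx).trans ?_
  have h1 := (optQ_mem hs hh s a).1
  have h2 := value_le_horizon (M := M) πs h s
  rw [← optValue_eq hs hh.le] at h2
  rw [EpisodicMDP.gap]
  linarith

end OptimalValues

/-! ### The finite set of visited pairs -/

section Coverage

variable {S : Type u} {A : Type v} {M : EpisodicMDP S A}

/-- The states which the behaviour visits at stage `h` with positive probability. -/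
def Behaviour.Visited (μ : Behaviour M) (h : ℕ) (s : S) : Prop :=
  M.stateOcc (μ.policy 0 Fin.elim0) h s ≠ 0

open Classical in
/-- The state-action pairs which the behaviour visits at stage `h` with positive probability
(as a finite set; junk if there are infinitely many of them). -/
def Behaviour.pairs (μ : Behaviour M) (h : ℕ) : Finset (S × A) :=
  if hf : {z : S × A | μ.Visited h z.1 ∧ z.2 ∈ μ.supp h z.1}.Finite then hf.toFinset else ∅

open Classical in
/-- The states which the behaviour visits at stage `h` with positive probability. -/
def Behaviour.states (μ : Behaviour M) (h : ℕ) : Finset S := (μ.pairs h).image Prod.fst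

lemma stateOcc_succ_ne_zero_iff (π : Policy S A) (h : ℕ) (s' : S) :
    M.stateOcc π (h + 1) s' ≠ 0 ↔
      ∃ s, M.stateOcc π h s ≠ 0 ∧ ∃ a, π h s a ≠ 0 ∧ M.P h s a s' ≠ 0 := by
  rw [EpisodicMDP.stateOcc, ← PMF.mem_support_iff, PMF.mem_support_bind_iff]
  simp only [PMF.mem_support_iff]
  refine exists_congr fun s => and_congr_right fun _ => ?_
  rw [← PMF.mem_support_iff, PMF.mem_support_bind_iff]
  simp only [PMF.mem_support_iff]

variable (μ : Behaviour M)

lemma Behaviour.policy_ne_zero_iff {k : ℕ} (D : Fin k → M.Traj) (h : ℕ) (s : S) (a : A) :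
    μ.policy k D h s a ≠ 0 ↔ a ∈ μ.supp h s := by
  rw [← μ.support_eq k D h s, PMF.mem_support_iff]

/-- Reachability depends on a policy only through its supports, and these are common to all episodes
and histories. -/
lemma Behaviour.stateOcc_ne_zero_iff {k : ℕ} (D : Fin k → M.Traj) (h : ℕ) (s : S) :
    M.stateOcc (μ.policy k D) h s ≠ 0 ↔ μ.Visited h s := by
  rw [Behaviour.Visited]
  induction h generalizing s with
  | zero => rfl
  | succ h ih =>
    simp only [stateOcc_succ_ne_zero_iff, ih, Behaviour.policy_ne_zero_iff]

lemma Behaviour.Visited.succ {μ : Behaviour M} {h : ℕ} {s s' : S} {a : A} (hs : μ.Visited h s)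
    (ha : a ∈ μ.supp h s) (hP : M.P h s a s' ≠ 0) : μ.Visited (h + 1) s' :=
  (stateOcc_succ_ne_zero_iff _ _ _).2 ⟨s, hs, a, (μ.policy_ne_zero_iff _ _ _ _).2 ha, hP⟩

lemma Behaviour.Visited.feasible {μ : Behaviour M} {h : ℕ} {s : S} (hs : μ.Visited h s) :
    M.Feasible h s := ⟨_, hs⟩

lemma Behaviour.occ_ne_zero_iff {k : ℕ} (D : Fin k → M.Traj) (h : ℕ) (s : S) (a : A) :
    M.occ (μ.policy k D) h s a ≠ 0 ↔ μ.Visited h s ∧ a ∈ μ.supp h s := by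
  rw [EpisodicMDP.occ, mul_ne_zero_iff, μ.stateOcc_ne_zero_iff, μ.policy_ne_zero_iff]

lemma occ_ne_top (π : Policy S A) (h : ℕ) (s : S) (a : A) : M.occ π h s a ≠ ∞ :=
  ENNReal.mul_ne_top (PMF.apply_ne_top _ _) (PMF.apply_ne_top _ _)

lemma tsum_occ (π : Policy S A) (h : ℕ) : ∑' z : S × A, M.occ π h z.1 z.2 = 1 := by
  rw [ENNReal.tsum_prod (f := fun s a => M.occ π h s a)]
  simp [EpisodicMDP.occ, ENNReal.tsum_mul_left, PMF.tsum_coe]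

lemma Behaviour.densityInf_le_occ {k : ℕ} (D : Fin k → M.Traj) {h : ℕ} {s : S} {a : A}
    (hs : μ.Visited h s) (ha : a ∈ μ.supp h s) :
    ENNReal.ofReal (μ.densityInf h) ≤ M.occ (μ.policy k D) h s a := by
  rw [← ENNReal.ofReal_toReal (occ_ne_top (μ.policy k D) h s a)]
  refine ENNReal.ofReal_le_ofReal (csInf_le ⟨0, ?_⟩ ⟨k, D, s, a, rfl, ?_⟩)
  · rintro _ ⟨k, D, s, a, rfl, h0⟩
    exact h0.le
  · exact ENNReal.toReal_pos ((μ.occ_ne_zero_iff D h s a).2 ⟨hs, ha⟩) (occ_ne_top _ _ _ _)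

variable {μ} {h : ℕ}

/-- The visitation probabilities of one stage sum to `1`, so only finitely many of them reach a
positive threshold. -/
lemma Behaviour.pairs_finite (hpos : 0 < μ.densityInf h) : {z : S × A | μ.Visited h z.1 ∧ z.2 ∈ μ.supp h z.1}.Finite := by
  have h1 := ENNReal.finite_const_le_of_tsum_ne_top
    (a := fun z : S × A => M.occ (μ.policy 0 Fin.elim0) h z.1 z.2)
    (by rw [tsum_occ]; exact ENNReal.one_ne_top) (ε := ENNReal.ofReal (μ.densityInf h))
    (by simpa using hpos)
  exact h1.subset fun z hz => μ.densityInf_le_occ _ hz.1 hz.2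

lemma Behaviour.mem_pairs (hpos : 0 < μ.densityInf h) {z : S × A} :
    z ∈ μ.pairs h ↔ μ.Visited h z.1 ∧ z.2 ∈ μ.supp h z.1 := by
  rw [Behaviour.pairs, dif_pos (Behaviour.pairs_finite hpos)]
  simp

lemma Behaviour.card_pairs_le (hpos : 0 < μ.densityInf h) : ((μ.pairs h).card : ℝ) ≤ (μ.densityInf h)⁻¹ := by
  rw [← one_div, le_div_iff₀ hpos]
  have h1 : ∑ z ∈ μ.pairs h, ENNReal.ofReal (μ.densityInf h) ≤ 1 := by
    rw [← tsum_occ (μ.policy 0 Fin.elim0) h]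
    refine le_trans (Finset.sum_le_sum fun z hz => ?_) (ENNReal.sum_le_tsum (μ.pairs h))
    exact μ.densityInf_le_occ _ ((Behaviour.mem_pairs hpos).1 hz).1
      ((Behaviour.mem_pairs hpos).1 hz).2
  rw [Finset.sum_const, nsmul_eq_mul, ← ENNReal.ofReal_natCast,
    ← ENNReal.ofReal_mul (Nat.cast_nonneg _), ENNReal.ofReal_le_one] at h1
  exact h1

open Classical in
lemma Behaviour.card_states_le : (μ.states h).card ≤ (μ.pairs h).card := Finset.card_image_le

lemma Behaviour.one_le_inv_densityInf (hpos : 0 < μ.densityInf h) : 1 ≤ (μ.densityInf h)⁻¹ := by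
  have hne : {x : ℝ | ∃ k D s a, x = (M.occ (μ.policy k D) h s a).toReal ∧ 0 < x}.Nonempty := by
    by_contra hne
    rw [Set.not_nonempty_iff_eq_empty] at hne
    rw [Behaviour.densityInf, hne, Real.sInf_empty] at hpos
    exact lt_irrefl _ hpos
  obtain ⟨x, k, D, s, a, rfl, hx⟩ := hne
  refine (one_le_inv₀ hpos).2 (le_trans (csInf_le ⟨0, ?_⟩ ⟨k, D, s, a, rfl, hx⟩) ?_)
  · rintro _ ⟨k, D, s, a, rfl, h0⟩
    exact h0.le
  · refine ENNReal.toReal_le_of_le_ofReal zero_le_one ?_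
    rw [ENNReal.ofReal_one, ← tsum_occ (μ.policy k D) h]
    exact ENNReal.le_tsum (f := fun z : S × A => M.occ (μ.policy k D) h z.1 z.2) (s, a)

lemma Behaviour.mem_states (hpos : 0 < μ.densityInf h) {s : S} (hs : μ.Visited h s) : s ∈ μ.states h := by
  obtain ⟨a, ha⟩ := (μ.policy 0 Fin.elim0 h s).support_nonempty
  rw [μ.support_eq] at ha
  classical
  exact Finset.mem_image.2 ⟨(s, a), (Behaviour.mem_pairs hpos).2 ⟨hs, ha⟩, rfl⟩

end Coverage

/-! ### Laws of trajectories and data sets, exponential moments -/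

section Laws

variable {S : Type u} {A : Type v} {M : EpisodicMDP S A}

/-- Initial segments of an episode follow the law of shorter episodes. -/
lemma lexp_trajLaw_castLE (π : Policy S A) {n N : ℕ} (hn : n ≤ N)
    (g : (Fin n → S × A) → ℝ≥0∞) :
    lexp (M.trajLaw π N) (fun τ => g fun i => τ (Fin.castLE hn i)) = lexp (M.trajLaw π n) g := by
  induction N, hn using Nat.le_induction with
  | base => rfl
  | succ N hn ih =>
    rw [EpisodicMDP.trajLaw, lexp_bind, ← ih]
    refine lexp_congr fun τ _ => ?_
    rw [lexp_bind]
    simp only [lexp_map]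
    have e : ∀ (s : S) (a : A),
        (fun i : Fin n => (Fin.snoc (α := fun _ => S × A) τ (s, a) : Fin (N + 1) → S × A)
          (Fin.castLE (hn.trans N.le_succ) i)) = fun i => τ (Fin.castLE hn i) := by
      intro s a
      funext i
      exact Fin.snoc_castSucc (α := fun _ => S × A) (s, a) τ (Fin.castLE hn i)
    simp only [e, lexp_const]

/-- The law of the next state at the end of a partial episode. -/
lemma trajLaw_bind_nextState (π : Policy S A) (n : ℕ) :
    (M.trajLaw π n).bind (M.nextState n) = M.stateOcc π n := by
  induction n with
  | zero => simp [EpisodicMDP.trajLaw, EpisodicMDP.nextState, EpisodicMDP.stateOcc]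
  | succ n ih =>
    rw [EpisodicMDP.trajLaw, EpisodicMDP.stateOcc, ← ih]
    simp only [PMF.bind_bind, PMF.bind_map]
    congr 1
    funext τ
    congr 1
    funext s
    congr 1
    funext a
    simp [EpisodicMDP.nextState]

lemma lexp_trajLaw_last (π : Policy S A) (n : ℕ) (f : S × A → ℝ≥0∞) :
    lexp (M.trajLaw π (n + 1)) (fun τ => f (τ (Fin.last n)))
      = lexp (M.stateOcc π n) fun s => lexp (π n s) fun a => f (s, a) := by
  rw [← trajLaw_bind_nextState, EpisodicMDP.trajLaw, lexp_bind, lexp_bind]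
  refine lexp_congr fun τ _ => ?_
  rw [lexp_bind]
  simp only [lexp_map, Fin.snoc_last]

/-- The law of the state-action pair at stage `h`. -/
lemma lexp_trajLaw_pair (π : Policy S A) (h : Fin M.H) (f : S × A → ℝ≥0∞) :
    lexp (M.trajLaw π M.H) (fun τ => f (τ h))
      = lexp (M.stateOcc π h) fun s => lexp (π h s) fun a => f (s, a) := by
  rw [← lexp_trajLaw_last, ← lexp_trajLaw_castLE π (Nat.succ_le_of_lt h.isLt)]
  rfl

/-- The law of the state-action pair at a stage and of the next state. -/
lemma lexp_trajLaw_next (π : Policy S A) {h : ℕ} (hh : h + 1 < M.H)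
    (f : S × A → S → ℝ≥0∞) :
    lexp (M.trajLaw π M.H) (fun τ => f (τ ⟨h, by omega⟩) (τ ⟨h + 1, hh⟩).1)
      = lexp (M.trajLaw π (h + 1)) fun τ =>
          lexp (M.P h (τ (Fin.last h)).1 (τ (Fin.last h)).2) (f (τ (Fin.last h))) := by
  have h1 := lexp_trajLaw_castLE (M := M) π (Nat.succ_le_of_lt hh) fun τ =>
    f (τ (Fin.last h).castSucc) (τ (Fin.last (h + 1))).1
  refine Eq.trans ?_ (h1.trans ?_)
  · rfl
  · rw [EpisodicMDP.trajLaw, lexp_bind]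
    refine lexp_congr fun τ _ => ?_
    rw [lexp_bind]
    simp only [lexp_map, Fin.snoc_last, Fin.snoc_castSucc, lexp_const]
    rfl

variable (μ : Behaviour M)

/-- The first episodes of a data set follow the law of the smaller data set. -/
lemma lexp_dataLaw_castLE {k K : ℕ} (hk : k ≤ K) (g : (Fin k → M.Traj) → ℝ≥0∞) :
    lexp (μ.dataLaw K) (fun D => g fun i => D (Fin.castLE hk i)) = lexp (μ.dataLaw k) g := by
  induction K, hk using Nat.le_induction with
  | base => rfl
  | succ K hk ih =>
    rw [Behaviour.dataLaw, lexp_bind, ← ih]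
    refine lexp_congr fun D _ => ?_
    rw [lexp_map]
    have e : ∀ τ : M.Traj,
        (fun i : Fin k => (Fin.snoc (α := fun _ => M.Traj) D τ : Fin (K + 1) → M.Traj)
          (Fin.castLE (hk.trans K.le_succ) i)) = fun i => D (Fin.castLE hk i) := by
      intro τ
      funext i
      exact Fin.snoc_castSucc (α := fun _ => M.Traj) τ D (Fin.castLE hk i)
    simp only [e, lexp_const]

variable {μ}

/-- Exponentials of sums over the episodes inherit the supermartingale property. -/
lemma lexp_dataLaw_exp_sum_le {y : M.Traj → ℝ}
    (hy : ∀ k D, lexp (M.trajLaw (μ.policy k D) M.H)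
      (fun τ => ENNReal.ofReal (Real.exp (y τ))) ≤ 1) (k : ℕ) :
    lexp (μ.dataLaw k) (fun D => ENNReal.ofReal (Real.exp (∑ t, y (D t)))) ≤ 1 := by
  induction k with
  | zero => simp [lexp_const]
  | succ k ih =>
    rw [Behaviour.dataLaw, lexp_bind]
    refine le_trans (lexp_mono fun D _ => ?_) ih
    rw [lexp_map]
    simp only [Fin.sum_univ_castSucc, Fin.snoc_castSucc, Fin.snoc_last, Real.exp_add,
      ENNReal.ofReal_mul (Real.exp_pos _).le, lexp_const_mul]
    -- Given the past, the new episode contributes a factor of mean at most `1`, whichever policy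
    -- the past has selected.
    exact mul_le_of_le_one_right' (hy k D)

lemma lexp_firstEpisodes_exp_sum_le {y : M.Traj → ℝ}
    (hy : ∀ k D, lexp (M.trajLaw (μ.policy k D) M.H)
      (fun τ => ENNReal.ofReal (Real.exp (y τ))) ≤ 1) {K : ℕ} (k : Fin K) :
    lexp (μ.dataLaw K)
      (fun D => ENNReal.ofReal (Real.exp (∑ t, y (firstEpisodes D k t)))) ≤ 1 :=
  (lexp_dataLaw_castLE μ k.isLt.le fun D => ENNReal.ofReal (Real.exp (∑ t, y (D t)))).trans_le
    (lexp_dataLaw_exp_sum_le hy k)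

/-- Almost surely, the observed pairs are visited with positive probability. -/
lemma visited_of_dataLaw_ne_zero {K : ℕ} {D : Fin K → M.Traj} (hD : μ.dataLaw K D ≠ 0)
    (t : Fin K) (h : Fin M.H) : μ.Visited h (D t h).1 ∧ (D t h).2 ∈ μ.supp h (D t h).1 := by
  classical
  have key : ∀ K (D : Fin K → M.Traj), μ.dataLaw K D ≠ 0 →
      ∀ t, ∃ k D', M.trajLaw (μ.policy k D') M.H (D t) ≠ 0 := by
    intro K
    induction K with
    | zero => exact fun _ _ t => t.elim0
    | succ K ih =>
      intro D hD t
      rw [Behaviour.dataLaw, ← PMF.mem_support_iff, PMF.mem_support_bind_iff] at hD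
      obtain ⟨D', hD', hD⟩ := hD
      rw [PMF.mem_support_map_iff] at hD
      obtain ⟨τ, hτ, rfl⟩ := hD
      refine Fin.lastCases ?_ (fun t => ?_) t
      · exact ⟨K, D', by rwa [Fin.snoc_last]⟩
      · rw [Fin.snoc_castSucc]
        exact ih D' hD' t
  obtain ⟨k, D', hτ⟩ := key K D hD t
  by_contra hcon
  -- The indicator of the unvisited pairs has mean zero at stage `h`, so an episode containing such
  -- a pair there has no mass.
  have h1 := lexp_trajLaw_pair (μ.policy k D') h fun z =>
    if μ.Visited h z.1 ∧ z.2 ∈ μ.supp h z.1 then 0 else 1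
  have h2 : (lexp (M.stateOcc (μ.policy k D') h) fun s => lexp (μ.policy k D' h s) fun a =>
      if μ.Visited h s ∧ a ∈ μ.supp h s then (0 : ℝ≥0∞) else 1) = 0 := by
    refine (lexp_congr fun s hs => ?_).trans (lexp_const _ 0)
    refine (lexp_congr fun a ha => if_pos ?_).trans (lexp_const _ 0)
    exact ⟨(μ.stateOcc_ne_zero_iff D' h s).1 hs, (μ.policy_ne_zero_iff D' h s a).1 ha⟩
  rw [h2, lexp, ENNReal.tsum_eq_zero] at h1
  have h3 := h1 (D t)
  rw [if_neg hcon, mul_one] at h3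
  exact hτ h3

open Classical in
/-- Exponential moment for the number of visits of a pair. -/
lemma lexp_visit_le {h : Fin M.H} {z : S × A} (hs : μ.Visited h z.1) (ha : z.2 ∈ μ.supp h z.1)
    (k : ℕ) (D : Fin k → M.Traj) :
    lexp (M.trajLaw (μ.policy k D) M.H) (fun τ => ENNReal.ofReal (Real.exp
      (μ.densityInf h / 2 - if τ h = z then Real.log 2 else 0))) ≤ 1 := by
  set π := μ.policy k D
  set ν := μ.densityInf h
  set p := (M.occ π h z.1 z.2).toReal with hp
  have hνp : ν ≤ p := by
    rw [hp, ← ENNReal.ofReal_le_iff_le_toReal (occ_ne_top _ _ _ _)]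
    exact μ.densityInf_le_occ D hs ha
  have hp1 : p ≤ 1 := by
    refine ENNReal.toReal_le_of_le_ofReal zero_le_one ?_
    rw [ENNReal.ofReal_one, ← tsum_occ π h]
    exact ENNReal.le_tsum (f := fun z : S × A => M.occ π h z.1 z.2) z
  have hsum : lexp (M.trajLaw π M.H) (fun τ => if τ h = z then 1 else 0) = ENNReal.ofReal p := by
    rw [lexp_trajLaw_pair π h fun x => if x = z then 1 else 0, hp,
      ENNReal.ofReal_toReal (occ_ne_top _ _ _ _), lexp, tsum_eq_single z.1, lexp,
      tsum_eq_single z.2]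
    · simp [EpisodicMDP.occ]
    · intro a ha
      simp [Prod.ext_iff, ha]
    · intro s hs
      simp [lexp, Prod.ext_iff, hs]
  have hle : lexp (M.trajLaw π M.H) (fun τ => if τ h = z then 0 else 1)
      = ENNReal.ofReal (1 - p) := by
    have h1 : lexp (M.trajLaw π M.H) (fun τ => if τ h = z then 0 else 1) + ENNReal.ofReal p
        = 1 := by
      rw [← hsum, ← lexp_add]
      refine (lexp_congr fun τ _ => ?_).trans (lexp_const (M.trajLaw π M.H) 1)
      split_ifs <;> simp
    rw [ENNReal.ofReal_sub _ ENNReal.toReal_nonneg, ENNReal.ofReal_one]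
    exact ENNReal.eq_sub_of_add_eq ENNReal.ofReal_ne_top h1
  have e : ∀ τ : M.Traj, ENNReal.ofReal (Real.exp (ν / 2 - if τ h = z then Real.log 2 else 0))
      = ENNReal.ofReal (Real.exp (ν / 2)) * ((ENNReal.ofReal 2⁻¹) * (if τ h = z then 1 else 0)
        + if τ h = z then 0 else 1) := by
    intro τ
    split_ifs
    · rw [Real.exp_sub, Real.exp_log two_pos, div_eq_mul_inv,
        ENNReal.ofReal_mul (Real.exp_pos _).le]
      simp
    · simp
  simp only [e, lexp_const_mul, lexp_add, hsum, hle]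
  rw [← ENNReal.ofReal_mul (by norm_num), ← ENNReal.ofReal_add (by positivity) (by linarith),
    ← ENNReal.ofReal_mul (Real.exp_pos _).le, ENNReal.ofReal_le_one]
  -- A visit halves the weight, so the mean weight is `1 - p/2 ≤ 1 - ν/2`.
  have h1 : 2⁻¹ * p + (1 - p) ≤ Real.exp (-(ν / 2)) := by
    have := Real.add_one_le_exp (-(ν / 2))
    linarith
  calc _ ≤ Real.exp (ν / 2) * Real.exp (-(ν / 2)) := by gcongr
    _ = 1 := by rw [← Real.exp_add]; simp

open Classical in
/-- Exponential moment for the transitions out of a pair. -/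
lemma lexp_transition_le {h : ℕ} (hh : h + 1 < M.H) (z : S × A) {f : S → ℝ}
    (hf : ∀ s, |f s| ≤ 1) (h0 : actionExp (M.P h z.1 z.2) f = 0) (l : ℝ) (π : Policy S A) :
    lexp (M.trajLaw π M.H) (fun τ => ENNReal.ofReal (Real.exp
      (if τ ⟨h, by omega⟩ = z then l * f (τ ⟨h + 1, hh⟩).1 - l ^ 2 / 2 else 0))) ≤ 1 := by
  rw [lexp_trajLaw_next π hh fun x s' => ENNReal.ofReal (Real.exp
    (if x = z then l * f s' - l ^ 2 / 2 else 0)), ← lexp_const (M.trajLaw π (h + 1)) 1]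
  refine lexp_mono fun τ _ => ?_
  by_cases hz : τ (Fin.last h) = z
  · have hb : ∀ s, |Real.exp (l * f s)| ≤ Real.exp |l| := fun s => by
      rw [abs_of_pos (Real.exp_pos _), Real.exp_le_exp]
      refine (le_abs_self _).trans ?_
      rw [abs_mul]
      exact mul_le_of_le_one_right (abs_nonneg _) (hf s)
    simp only [hz, if_true, Real.exp_sub, div_eq_inv_mul _ (Real.exp (l ^ 2 / 2)),
      ENNReal.ofReal_mul (inv_nonneg.2 (Real.exp_pos (l ^ 2 / 2)).le), lexp_const_mul]
    rw [lexp_ofReal hb fun s => (Real.exp_pos _).le,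
      ← ENNReal.ofReal_mul (inv_nonneg.2 (Real.exp_pos (l ^ 2 / 2)).le), ENNReal.ofReal_le_one]
    rw [inv_mul_le_iff₀ (Real.exp_pos _), mul_one]
    exact actionExp_exp_le hf h0 l
  · simp [hz, lexp_const]

end Laws

/-! ### Concentration of visit counts and transition frequencies -/

section Concentration

variable {S : Type u} {A : Type v} {M : EpisodicMDP S A}

open Classical in
/-- The number of visits of the pair `z` at stage `h`. -/
def visits {n : ℕ} (D : Fin n → M.Traj) (h : Fin M.H) (z : S × A) : ℕ :=
  (Finset.univ.filter fun t => D t h = z).card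

open Classical in
/-- The accumulated difference between the observed and the expected values of `V` at the
transitions out of the pair `z`. -/
def deviation {n : ℕ} (D : Fin n → M.Traj) (h : Fin M.H) (V : S → ℝ) (z : S × A) : ℝ :=
  ∑ t, if D t h = z then target D h V t - M.nextExp h V z.1 z.2 else 0

open Classical in
/-- The data set `D` is typical: all pairs are visited sufficiently often, and the empirical
transition frequencies of all sets of states are accurate. -/
structure Concentrated (μ : Behaviour M) (L : ℝ) {n : ℕ} (D : Fin n → M.Traj) : Prop where
  visited : ∀ t (h : Fin M.H), μ.Visited h (D t h).1 ∧ (D t h).2 ∈ μ.supp h (D t h).1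
  le_visits : ∀ h : Fin M.H, ∀ z ∈ μ.pairs h, n * (μ.densityInf h / 2) - L ≤ visits D h z
  -- One side suffices, since `V` may be replaced by `c - V`. The summand `log 2` per state pays for
  -- the choice of `B`.
  deviation_le : ∀ h : Fin M.H, (h : ℕ) + 1 < M.H → ∀ z ∈ μ.pairs h, ∀ B ⊆ μ.states (h + 1),
    deviation D h (fun s => if s ∈ B then 1 else 0) z
      ≤ √(2 * visits D h z * (L + (μ.states (h + 1)).card * Real.log 2))

lemma visits_le {n : ℕ} (D : Fin n → M.Traj) (h : Fin M.H) (z : S × A) : visits D h z ≤ n := by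
  classical
  exact (Finset.card_le_univ _).trans_eq (Fintype.card_fin n)

open Classical in
lemma sum_ite_visits {n : ℕ} (D : Fin n → M.Traj) (h : Fin M.H) (z : S × A) (c : ℝ) :
    (∑ t, if D t h = z then c else 0) = visits D h z * c := by
  rw [← Finset.sum_filter, Finset.sum_const, nsmul_eq_mul, visits]

/-- Chernoff's bound. -/
lemma toOuterMeasure_lt_le_exp_neg {α : Type*} (p : PMF α) {Y : α → ℝ}
    (hY : lexp p (fun x => ENNReal.ofReal (Real.exp (Y x))) ≤ 1) (L : ℝ) :
    p.toOuterMeasure {x | L < Y x} ≤ ENNReal.ofReal (Real.exp (-L)) := by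
  refine (toOuterMeasure_le_lexp_div p (fun x => ENNReal.ofReal (Real.exp (Y x))) _
    (c := ENNReal.ofReal (Real.exp L)) (by simp [Real.exp_pos]) ENNReal.ofReal_ne_top
    fun x hx _ => ENNReal.ofReal_le_ofReal (Real.exp_le_exp.2 (le_of_lt hx))).trans ?_
  rw [Real.exp_neg, ENNReal.ofReal_inv_of_pos (Real.exp_pos _), ENNReal.div_eq_inv_mul]
  exact mul_le_of_le_one_right' hY

variable {μ : Behaviour M}

lemma measure_visits_lt_le {K : ℕ} (k : Fin K) {h : Fin M.H} {z : S × A}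
    (hs : μ.Visited h z.1) (ha : z.2 ∈ μ.supp h z.1) (L : ℝ) :
    (μ.dataLaw K).toOuterMeasure {D | ¬ ((k : ℕ) * (μ.densityInf h / 2) - L
      ≤ visits (firstEpisodes D k) h z)} ≤ ENNReal.ofReal (Real.exp (-L)) := by
  classical
  refine le_trans (MeasureTheory.OuterMeasure.mono _ fun D hD => ?_)
    (toOuterMeasure_lt_le_exp_neg _ (lexp_firstEpisodes_exp_sum_le (lexp_visit_le hs ha) k) L)
  simp only [Set.mem_ofPred_eq, not_le, Finset.sum_sub_distrib, sum_ite_visits, Finset.sum_const,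
    Finset.card_univ, Fintype.card_fin, nsmul_eq_mul] at hD ⊢
  have h1 : (visits (firstEpisodes D k) h z : ℝ) * Real.log 2
      ≤ visits (firstEpisodes D k) h z :=
    mul_le_of_le_one_right (Nat.cast_nonneg _) (by linarith [Real.log_two_lt_d9])
  linarith

-- The tilt of the exponential moment must be deterministic, while its best value depends on the
-- random number of visits. Prescribing that number resolves the conflict, at the price of a union
-- bound over `n`.
open Classical in
lemma measure_deviation_lt_le {K : ℕ} (k : Fin K) {h : Fin M.H} (hh : (h : ℕ) + 1 < M.H)
    (z : S × A) (B : Finset S) (n : ℕ) {L : ℝ} (hL : 0 < L) :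
    (μ.dataLaw K).toOuterMeasure {D | visits (firstEpisodes D k) h z = n ∧
      ¬ deviation (firstEpisodes D k) h (fun s => if s ∈ B then 1 else 0) z
        ≤ √(2 * visits (firstEpisodes D k) h z * L)} ≤ ENNReal.ofReal (Real.exp (-L)) := by
  set g : S → ℝ := fun s => if s ∈ B then 1 else 0 with hg
  have hg0 : ∀ s, 0 ≤ g s := fun s => by simp only [hg]; split_ifs <;> norm_num
  have hg1 : ∀ s, g s ≤ 1 := fun s => by simp only [hg]; split_ifs <;> norm_num
  have hgb : ∀ s, |g s| ≤ 1 := fun s => abs_le_of_mem_zero_le (hg0 s) (hg1 s)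
  set m := actionExp (M.P h z.1 z.2) g with hm
  have hm0 : 0 ≤ m := le_actionExp_of_le hgb fun s _ => hg0 s
  have hm1 : m ≤ 1 := actionExp_le_of_le hgb fun s _ => hg1 s
  have hf : ∀ s, |g s - m| ≤ 1 := fun s => by
    rw [abs_le]
    constructor <;> linarith [hg0 s, hg1 s]
  have hf0 : actionExp (M.P h z.1 z.2) (fun s => g s - m) = 0 := by
    rw [actionExp_sub hgb (fun _ => le_rfl), actionExp_const, ← hm, sub_self]
  -- The optimal tilt for `n` visits: a deviation above `√(2nL) = n l` makes the exponent exceed `n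
  -- l² - n l²/2 = L`.
  set l := √(2 * L / n) with hl
  refine le_trans (MeasureTheory.OuterMeasure.mono _ fun D hD => ?_)
    (toOuterMeasure_lt_le_exp_neg _ (lexp_firstEpisodes_exp_sum_le
      (fun k D => lexp_transition_le hh z hf hf0 l (μ.policy k D)) k) L)
  obtain ⟨hn, hD⟩ := hD
  rw [not_le, hn] at hD
  rw [Set.mem_ofPred_eq]
  set D' := firstEpisodes D k
  have e : ∑ t, (if D' t ⟨h, by omega⟩ = z then
      l * (g (D' t ⟨h + 1, hh⟩).1 - m) - l ^ 2 / 2 else 0)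
      = l * deviation D' h g z - n * (l ^ 2 / 2) := by
    rw [← hn, ← sum_ite_visits, deviation, Finset.mul_sum, ← Finset.sum_sub_distrib]
    refine Finset.sum_congr rfl fun t _ => ?_
    simp only [Fin.eta, target, dif_pos hh]
    split_ifs
    · rfl
    · simp
  rw [e]
  rcases Nat.eq_zero_or_pos n with h0 | h0
  · exfalso
    have hz : deviation D' h g z = 0 := by
      refine Finset.sum_eq_zero fun t _ => if_neg fun ht => ?_
      rw [h0, visits, Finset.card_eq_zero, Finset.filter_eq_empty_iff] at hn
      exact hn (Finset.mem_univ t) ht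
    rw [hz, h0] at hD
    simp at hD
  · have hn0 : (0 : ℝ) < n := by exact_mod_cast h0
    have hl0 : 0 < l := Real.sqrt_pos.2 (by positivity)
    have hl2 : n * l ^ 2 = 2 * L := by
      rw [hl, Real.sq_sqrt (by positivity)]
      field_simp
    have hs : √(2 * n * L) = n * l := by
      rw [Real.sqrt_eq_iff_mul_self_eq (by positivity) (by positivity)]
      linear_combination -n * hl2
    rw [hs] at hD
    have h2 := mul_lt_mul_of_pos_left hD hl0
    nlinarith

lemma natCast_mul_one_add_le (K : ℕ) : (K : ℝ) * (1 + K) ≤ 2 * K ^ 2 := by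
  have : (K : ℝ) ≤ K ^ 2 := by exact_mod_cast Nat.le_self_pow two_ne_zero K
  nlinarith

lemma sum_sum_sum_ofReal_const {ι : Type*} (K : ℕ) {n : ℕ} (P : Fin n → Finset ι) {r : ℝ}
    (hr : 0 ≤ r) : ∑ _k : Fin K, ∑ i, ∑ _z ∈ P i, ENNReal.ofReal r
      = ENNReal.ofReal (K * ∑ i, (P i).card * r) := by
  rw [ENNReal.ofReal_mul (Nat.cast_nonneg K), ENNReal.ofReal_natCast,
    ENNReal.ofReal_sum_of_nonneg fun i _ => mul_nonneg (Nat.cast_nonneg _) hr]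
  rw [Finset.sum_const, Finset.card_univ, Fintype.card_fin, nsmul_eq_mul]
  congr 1
  refine Finset.sum_congr rfl fun i _ => ?_
  rw [Finset.sum_const, nsmul_eq_mul, ENNReal.ofReal_mul (Nat.cast_nonneg _),
    ENNReal.ofReal_natCast]

lemma card_pairs_total_le (hpos : ∀ h < M.H, 0 < μ.densityInf h) (K : ℕ) {r : ℝ} (hr : 0 ≤ r) :
    (K : ℝ) * ∑ h : Fin M.H, ((μ.pairs h).card : ℝ) * ((1 + K) * r) ≤ 2 * μ.kappa * K ^ 2 * r := by
  have h1 : ∑ h : Fin M.H, ((μ.pairs h).card : ℝ) ≤ μ.kappa := by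
    rw [Behaviour.kappa, ← Fin.sum_univ_eq_sum_range (fun h => (μ.densityInf h)⁻¹)]
    exact Finset.sum_le_sum fun h _ => Behaviour.card_pairs_le (hpos h h.isLt)
  have h2 := natCast_mul_one_add_le K
  have h3 : 0 ≤ ∑ h : Fin M.H, ((μ.pairs h).card : ℝ) :=
    Finset.sum_nonneg fun _ _ => Nat.cast_nonneg _
  rw [← Finset.sum_mul]
  generalize ∑ h : Fin M.H, ((μ.pairs h).card : ℝ) = T at *
  calc (K : ℝ) * (T * ((1 + K) * r)) = T * (K * (1 + K)) * r := by ring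
    _ ≤ μ.kappa * (2 * K ^ 2) * r := by
        gcongr
        exact h3.trans h1
    _ = _ := by ring

/-- With high probability, the first episodes form typical data sets. -/
theorem measure_not_concentrated_le (hpos : ∀ h < M.H, 0 < μ.densityInf h) (K : ℕ) {L : ℝ}
    (hL : 0 < L) :
    (μ.dataLaw K).toOuterMeasure {D | ∀ k : Fin K, Concentrated μ L (firstEpisodes D k)}ᶜ
      ≤ ENNReal.ofReal (2 * μ.kappa * K ^ 2 * Real.exp (-L)) := by
  classical
  set p := (μ.dataLaw K).toOuterMeasure with hp
  set badV : Fin K → (h : Fin M.H) → S × A → Set (Fin K → M.Traj) := fun k h z =>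
    {D | ¬ ((k : ℕ) * (μ.densityInf h / 2) - L ≤ visits (firstEpisodes D k) h z)}
  set X : Fin M.H → Finset S := fun h => μ.states (h + 1) with hX
  set badD : Fin K → (h : Fin M.H) → S × A → ℕ → Finset S → Set (Fin K → M.Traj) :=
    fun k h z n B => if (h : ℕ) + 1 < M.H then {D | visits (firstEpisodes D k) h z = n ∧
      ¬ deviation (firstEpisodes D k) h (fun s => if s ∈ B then 1 else 0) z
        ≤ √(2 * visits (firstEpisodes D k) h z * (L + (X h).card * Real.log 2))} else ∅
    with hbD
  have hV : ∀ k (h : Fin M.H), ∀ z ∈ μ.pairs h, p (badV k h z) ≤ ENNReal.ofReal (Real.exp (-L)) :=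
    fun k h z hz =>
      have hz' := (Behaviour.mem_pairs (hpos h h.isLt)).1 hz
      measure_visits_lt_le k hz'.1 hz'.2 L
  -- The factor `2^{-|X h|}` will cancel the number of subsets `B` of `X h`.
  have hD : ∀ k h z n B, p (badD k h z n B)
      ≤ ENNReal.ofReal (Real.exp (-L) * ((2 : ℝ) ^ (X h).card)⁻¹) := by
    intro k h z n B
    simp only [hbD]
    split_ifs with hh
    · refine (measure_deviation_lt_le k hh z B n
        (L := L + (X h).card * Real.log 2) (by positivity)).trans_eq ?_
      rw [neg_add, Real.exp_add, Real.exp_neg ((X h).card * Real.log 2), mul_comm (_ : ℝ) (Real.log 2),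
        Real.exp_mul, Real.exp_log two_pos, Real.rpow_natCast]
    · simp
  -- Null data sets are split off because observed pairs are visited pairs only almost surely. Fewer
  -- than `K` episodes are used, so the visit count lies in `Finset.range K`.
  have hsub : {D | ∀ k : Fin K, Concentrated μ L (firstEpisodes D k)}ᶜ ⊆
      {D | μ.dataLaw K D = 0} ∪ ⋃ k ∈ (Finset.univ : Finset (Fin K)),
        ⋃ h ∈ (Finset.univ : Finset (Fin M.H)), ⋃ z ∈ μ.pairs h,
          (badV k h z ∪ ⋃ n ∈ Finset.range K, ⋃ B ∈ (X h).powerset, badD k h z n B) := by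
    intro D hDc
    by_contra hcon
    simp only [Set.mem_union, Set.mem_iUnion, Finset.mem_univ, exists_prop, true_and, not_or,
      not_exists, not_and, Set.mem_ofPred_eq] at hcon
    obtain ⟨h0, hcon⟩ := hcon
    refine hDc fun k => ⟨fun t h => visited_of_dataLaw_ne_zero h0 _ h,
      fun h z hz => not_not.1 (hcon k h z hz).1, fun h hh z hz B hB => ?_⟩
    have h1 := (hcon k h z hz).2 (visits (firstEpisodes D k) h z)
      (Finset.mem_range.2 ((visits_le _ h z).trans_lt k.isLt)) B (Finset.mem_powerset.2 hB)
    simp only [hbD, if_pos hh, Set.mem_ofPred_eq, true_and, not_not] at h1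
    exact h1
  have hnull : p {D | μ.dataLaw K D = 0} = 0 := by
    rw [hp, PMF.toOuterMeasure_apply_eq_zero_iff, Set.disjoint_left]
    exact fun D h1 h2 => h1 h2
  have hK : (0 : ℝ) ≤ K := Nat.cast_nonneg K
  have hcard : ∀ h : Fin M.H, ((μ.pairs h).card : ℝ) ≤ (μ.densityInf h)⁻¹ := fun h =>
    Behaviour.card_pairs_le (hpos h h.isLt)
  have hz : ∀ k (h : Fin M.H), ∀ z ∈ μ.pairs h,
      p (badV k h z ∪ ⋃ n ∈ Finset.range K, ⋃ B ∈ (X h).powerset, badD k h z n B)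
        ≤ ENNReal.ofReal ((1 + K) * Real.exp (-L)) := by
    intro k h z hz
    refine (MeasureTheory.measure_union_le _ _).trans ?_
    rw [one_add_mul, ENNReal.ofReal_add (Real.exp_pos _).le (by positivity)]
    refine add_le_add (hV k h z hz) ?_
    calc p (⋃ n ∈ Finset.range K, ⋃ B ∈ (X h).powerset, badD k h z n B)
        ≤ ∑ n ∈ Finset.range K, ∑ B ∈ (X h).powerset,
            ENNReal.ofReal (Real.exp (-L) * ((2 : ℝ) ^ (X h).card)⁻¹) := by
          refine (MeasureTheory.measure_biUnion_finset_le _ _).trans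
            (Finset.sum_le_sum fun n _ => ?_)
          exact (MeasureTheory.measure_biUnion_finset_le _ _).trans
            (Finset.sum_le_sum fun B _ => hD k h z n B)
      _ = ENNReal.ofReal (K * Real.exp (-L)) := by
          simp only [Finset.sum_const, Finset.card_powerset, Finset.card_range, nsmul_eq_mul]
          rw [← ENNReal.ofReal_natCast, ← ENNReal.ofReal_natCast,
            ← ENNReal.ofReal_mul (by positivity), ← ENNReal.ofReal_mul (by positivity)]
          congr 1
          push_cast
          field_simp
  calc p {D | ∀ k : Fin K, Concentrated μ L (firstEpisodes D k)}ᶜ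
      ≤ 0 + ∑ k : Fin K, ∑ h : Fin M.H, ∑ z ∈ μ.pairs h,
          ENNReal.ofReal ((1 + K) * Real.exp (-L)) := by
        refine (MeasureTheory.measure_mono hsub).trans
          ((MeasureTheory.measure_union_le _ _).trans (add_le_add hnull.le ?_))
        refine (MeasureTheory.measure_biUnion_finset_le _ _).trans
          (Finset.sum_le_sum fun k _ => ?_)
        refine (MeasureTheory.measure_biUnion_finset_le _ _).trans
          (Finset.sum_le_sum fun h _ => ?_)
        exact (MeasureTheory.measure_biUnion_finset_le _ _).trans
          (Finset.sum_le_sum fun z hz' => hz k h z hz')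
    _ = ENNReal.ofReal (K * ∑ h : Fin M.H, (μ.pairs h).card * ((1 + K) * Real.exp (-L))) := by
        rw [zero_add]
        exact sum_sum_sum_ofReal_const K (fun h : Fin M.H => μ.pairs h) (by positivity)
    _ ≤ ENNReal.ofReal (2 * μ.kappa * K ^ 2 * Real.exp (-L)) := by
        refine ENNReal.ofReal_le_ofReal ?_
        exact card_pairs_total_le hpos K (Real.exp_pos (-L)).le

open Classical in
/-- Typical data sets give accurate estimates for all functions of the next state at once. -/
lemma Concentrated.abs_deviation_le (hpos : ∀ h < M.H, 0 < μ.densityInf h) {L : ℝ} {n : ℕ}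
    {D : Fin n → M.Traj} (hD : Concentrated μ L D) {h : Fin M.H} (hh : (h : ℕ) + 1 < M.H)
    {z : S × A} (hz : z ∈ μ.pairs h) {V : S → ℝ} {c : ℝ} (hV : ∀ s, V s ∈ Set.Icc 0 c) :
    |deviation D h V z|
      ≤ c * √(2 * visits D h z * (L + (μ.states (h + 1)).card * Real.log 2)) := by
  obtain ⟨hz1, hz2⟩ := (Behaviour.mem_pairs (hpos h h.isLt)).1 hz
  set X := μ.states (h + 1) with hX
  -- The deviation is linear in `V` with coefficients `x s'`. Among functions with values in `[0,
  -- c]` it is largest at `c` times the indicator of `{x > 0}`, which is an admissible set `B`.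
  set x : S → ℝ := fun s' => ∑ t, if D t h = z then
    ((if (D t ⟨h + 1, hh⟩).1 = s' then 1 else 0) - (M.P h z.1 z.2 s').toReal) else 0 with hx
  have hrep : ∀ V : S → ℝ, deviation D h V z = ∑ s' ∈ X, V s' * x s' := by
    intro V
    have hP : M.nextExp h V z.1 z.2 = ∑ s' ∈ X, V s' * (M.P h z.1 z.2 s').toReal := by
      rw [EpisodicMDP.nextExp, tsum_eq_sum (s := X)]
      · exact Finset.sum_congr rfl fun s' _ => mul_comm _ _
      · intro s' hs'
        by_cases h0 : M.P h z.1 z.2 s' = 0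
        · simp [h0]
        · exact absurd (Behaviour.mem_states (hpos _ hh) (hz1.succ hz2 h0)) hs'
    have hT : ∀ t, target D h V t
        = ∑ s' ∈ X, V s' * (if (D t ⟨h + 1, hh⟩).1 = s' then 1 else 0) := by
      intro t
      have hm : (D t ⟨h + 1, hh⟩).1 ∈ X :=
        Behaviour.mem_states (hpos _ hh) (hD.visited t ⟨h + 1, hh⟩).1
      simp [target, dif_pos hh, hm]
    simp only [hx, Finset.mul_sum]
    rw [Finset.sum_comm, deviation]
    refine Finset.sum_congr rfl fun t _ => ?_
    split_ifs
    · rw [hT, hP, ← Finset.sum_sub_distrib]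
      exact Finset.sum_congr rfl fun s' _ => by ring
    · simp
  have hone : ∀ V : S → ℝ, (∀ s, V s ∈ Set.Icc 0 c) → deviation D h V z
      ≤ c * √(2 * visits D h z * (L + X.card * Real.log 2)) := by
    intro V hV
    have hc : 0 ≤ c := (hV z.1).1.trans (hV z.1).2
    refine le_trans ?_ (mul_le_mul_of_nonneg_left
      (hD.deviation_le h hh z hz (X.filter fun s' => 0 < x s') (Finset.filter_subset _ _)) hc)
    rw [hrep, hrep, Finset.mul_sum]
    refine Finset.sum_le_sum fun s' hs' => ?_
    by_cases h0 : 0 < x s'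
    · simp only [Finset.mem_filter, hs', h0, and_self, if_true, one_mul]
      exact mul_le_mul_of_nonneg_right (hV s').2 h0.le
    · simp only [Finset.mem_filter, h0, and_false, if_false, zero_mul, mul_zero]
      exact mul_nonpos_of_nonneg_of_nonpos (hV s').1 (not_lt.1 h0)
  rw [abs_le]
  refine ⟨?_, hone V hV⟩
  have h1 := hone (fun s => c - V s) fun s => ⟨sub_nonneg.2 (hV s).2, sub_le_self _ (hV s).1⟩
  have hVb : ∀ s, |V s| ≤ c := fun s => abs_le_of_mem_zero_le (hV s).1 (hV s).2
  have h2 : deviation D h (fun s => c - V s) z = -deviation D h V z := by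
    rw [deviation, deviation, ← Finset.sum_neg_distrib]
    refine Finset.sum_congr rfl fun t _ => ?_
    have hP : M.nextExp h (fun s => c - V s) z.1 z.2 = c - M.nextExp h V z.1 z.2 :=
      (actionExp_sub (p := M.P h z.1 z.2) (fun _ => le_rfl) hVb).trans
        (by rw [actionExp_const]; rfl)
    split_ifs
    · rw [hP, target, target, dif_pos hh, dif_pos hh]
      ring
    · simp
  linarith

end Concentration

/-! ### Deterministic error bounds for ridge regression -/

section Regression

open Matrix

variable {d : ℕ} {ι : Type*} {n : ℕ}

/-- The regularized Gram matrix of a finite family of vectors. -/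
def ridgeGram (ψ : Fin n → Fin d → ℝ) : Matrix (Fin d) (Fin d) ℝ :=
  ∑ t, vecMulVec (ψ t) (ψ t) + (1 : ℝ) • (1 : Matrix (Fin d) (Fin d) ℝ)

lemma ridgeGram_mulVec (ψ : Fin n → Fin d → ℝ) (u : Fin d → ℝ) :
    ridgeGram ψ *ᵥ u = ∑ t, (ψ t ⬝ᵥ u) • ψ t + u := by
  rw [ridgeGram, add_mulVec, sum_mulVec, one_smul, one_mulVec]
  simp [vecMulVec_mulVec]

lemma dotProduct_ridgeGram_mulVec (ψ : Fin n → Fin d → ℝ) (v u : Fin d → ℝ) :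
    v ⬝ᵥ (ridgeGram ψ *ᵥ u) = ∑ t, (ψ t ⬝ᵥ u) * (ψ t ⬝ᵥ v) + v ⬝ᵥ u := by
  rw [ridgeGram_mulVec, dotProduct_add, dotProduct_sum]
  simp [dotProduct_comm v]

/-- The quadratic form is a sum of squares plus `v ⬝ᵥ v`, so the kernel is trivial. -/
lemma ridgeGram_isUnit_det (ψ : Fin n → Fin d → ℝ) : IsUnit (ridgeGram ψ).det := by
  rw [isUnit_iff_ne_zero]
  intro h0
  obtain ⟨v, hv, h1⟩ := exists_mulVec_eq_zero_iff.2 h0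
  have h2 := dotProduct_ridgeGram_mulVec ψ v v
  rw [h1, dotProduct_zero] at h2
  have h3 : 0 ≤ ∑ t, (ψ t ⬝ᵥ v) * (ψ t ⬝ᵥ v) :=
    Finset.sum_nonneg fun t _ => mul_self_nonneg _
  have h4 : 0 ≤ v ⬝ᵥ v := Finset.sum_nonneg fun t _ => mul_self_nonneg _
  exact hv (dotProduct_self_eq_zero.1 (by linarith))

lemma ridgeGram_mulVec_inv (ψ : Fin n → Fin d → ℝ) (x : Fin d → ℝ) :
    ridgeGram ψ *ᵥ ((ridgeGram ψ)⁻¹ *ᵥ x) = x := by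
  rw [mulVec_mulVec, mul_nonsing_inv _ (ridgeGram_isUnit_det ψ), one_mulVec]

lemma dotProduct_ridgeGram_inv_mulVec (ψ : Fin n → Fin d → ℝ) (x b : Fin d → ℝ) :
    x ⬝ᵥ ((ridgeGram ψ)⁻¹ *ᵥ b) = ((ridgeGram ψ)⁻¹ *ᵥ x) ⬝ᵥ b := by
  have h1 := dotProduct_ridgeGram_mulVec ψ ((ridgeGram ψ)⁻¹ *ᵥ b) ((ridgeGram ψ)⁻¹ *ᵥ x)
  have h2 := dotProduct_ridgeGram_mulVec ψ ((ridgeGram ψ)⁻¹ *ᵥ x) ((ridgeGram ψ)⁻¹ *ᵥ b)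
  rw [ridgeGram_mulVec_inv] at h1 h2
  rw [dotProduct_comm x, h1, h2, dotProduct_comm ((ridgeGram ψ)⁻¹ *ᵥ b)]
  congr 1
  exact Finset.sum_congr rfl fun t _ => mul_comm _ _

/-- The squared norm `xᵀ Σ⁻¹ x`. -/
lemma dotProduct_ridgeGram_inv_self (ψ : Fin n → Fin d → ℝ) (x : Fin d → ℝ) :
    x ⬝ᵥ ((ridgeGram ψ)⁻¹ *ᵥ x) = ∑ t, (ψ t ⬝ᵥ ((ridgeGram ψ)⁻¹ *ᵥ x)) ^ 2
      + ((ridgeGram ψ)⁻¹ *ᵥ x) ⬝ᵥ ((ridgeGram ψ)⁻¹ *ᵥ x) := by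
  have h1 := dotProduct_ridgeGram_mulVec ψ ((ridgeGram ψ)⁻¹ *ᵥ x) ((ridgeGram ψ)⁻¹ *ᵥ x)
  rw [ridgeGram_mulVec_inv, dotProduct_comm] at h1
  rw [h1]
  simp only [sq]

/-- Decomposition of the error of ridge regression. -/
lemma ridge_error_eq (ψ : Fin n → Fin d → ℝ) (x w : Fin d → ℝ) (y : Fin n → ℝ) :
    x ⬝ᵥ ((ridgeGram ψ)⁻¹ *ᵥ ∑ t, y t • ψ t) - x ⬝ᵥ w
      = ∑ t, (ψ t ⬝ᵥ ((ridgeGram ψ)⁻¹ *ᵥ x)) * (y t - ψ t ⬝ᵥ w)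
        - ((ridgeGram ψ)⁻¹ *ᵥ x) ⬝ᵥ w := by
  -- Substitute `x = Σ u`, `u = Σ⁻¹ x`, in `x ⬝ᵥ w`; the regularization leaves the bias `u ⬝ᵥ w`.
  have h1 := dotProduct_ridgeGram_mulVec ψ w ((ridgeGram ψ)⁻¹ *ᵥ x)
  rw [ridgeGram_mulVec_inv] at h1
  rw [dotProduct_ridgeGram_inv_mulVec, dotProduct_comm x, h1, dotProduct_sum]
  simp only [dotProduct_smul, smul_eq_mul, mul_sub, Finset.sum_sub_distrib,
    dotProduct_comm w]
  rw [← sub_sub]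
  congr 2
  exact Finset.sum_congr rfl fun t _ => by rw [dotProduct_comm, mul_comm]

/-- The width of ridge regression at a design point which occurs `N` times. -/
lemma ridgeGram_inv_le_of_visits [DecidableEq ι] (ψ : ι → Fin d → ℝ) (z : Fin n → ι) (i : ι)
    (hN : 0 < (Finset.univ.filter fun t => z t = i).card) :
    ψ i ⬝ᵥ ((ridgeGram fun t => ψ (z t))⁻¹ *ᵥ ψ i)
      ≤ ((Finset.univ.filter fun t => z t = i).card : ℝ)⁻¹ := by
  set N := (Finset.univ.filter fun t => z t = i).card with hNdef
  have h1 := dotProduct_ridgeGram_inv_self (fun t => ψ (z t)) (ψ i)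
  set u := (ridgeGram fun t => ψ (z t))⁻¹ *ᵥ ψ i
  set q := ψ i ⬝ᵥ u
  -- The `N` copies of `ψ i` alone give `N q² ≤ ∑ (ψ ⬝ᵥ u)² ≤ q`, hence `q ≤ 1/N`.
  have h2 : N * q ^ 2 ≤ ∑ t, (ψ (z t) ⬝ᵥ u) ^ 2 := by
    calc (N : ℝ) * q ^ 2 = ∑ t ∈ Finset.univ.filter fun t => z t = i, (ψ (z t) ⬝ᵥ u) ^ 2 := by
          rw [Finset.sum_congr rfl (g := fun _ => q ^ 2) fun t ht => by
            rw [(Finset.mem_filter.1 ht).2], Finset.sum_const, nsmul_eq_mul]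
      _ ≤ _ := Finset.sum_le_sum_of_subset_of_nonneg (Finset.filter_subset _ _)
          fun t _ _ => sq_nonneg _
  have h3 : 0 ≤ u ⬝ᵥ u := Finset.sum_nonneg fun t _ => mul_self_nonneg _
  have hN0 : (0 : ℝ) < N := by exact_mod_cast hN
  rw [← one_div, le_div_iff₀ hN0]
  by_contra hcon
  have hq : 0 < q := by
    by_contra hq
    have : q * N ≤ 0 := mul_nonpos_of_nonpos_of_nonneg (not_lt.1 hq) hN0.le
    linarith
  nlinarith [mul_lt_mul_of_pos_right (not_le.1 hcon) hq]

lemma abs_dotProduct_le (u w : Fin d → ℝ) : |u ⬝ᵥ w| ≤ √(u ⬝ᵥ u) * √(w ⬝ᵥ w) := by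
  have h0 : 0 ≤ u ⬝ᵥ u := Finset.sum_nonneg fun t _ => mul_self_nonneg _
  rw [← Real.sqrt_sq_eq_abs, ← Real.sqrt_mul h0]
  refine Real.sqrt_le_sqrt ?_
  have := Finset.sum_mul_sq_le_sq_mul_sq Finset.univ u w
  simpa only [dotProduct, sq] using this

/-- Error of ridge regression when the noise is controlled on every level set of the design. -/
lemma abs_ridge_error_le [DecidableEq ι] (ψ : ι → Fin d → ℝ) (z : Fin n → ι) (F : Finset ι)
    (hF : ∀ t, z t ∈ F) (x w : Fin d → ℝ) (y : Fin n → ℝ) {c b : ℝ} (hc : 0 ≤ c)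
    (hw : √(w ⬝ᵥ w) ≤ b)
    (hnoise : ∀ i ∈ F, |∑ t, if z t = i then y t - ψ i ⬝ᵥ w else 0|
      ≤ c * √((Finset.univ.filter fun t => z t = i).card)) :
    |x ⬝ᵥ ((ridgeGram fun t => ψ (z t))⁻¹ *ᵥ ∑ t, y t • ψ (z t)) - x ⬝ᵥ w|
      ≤ √(x ⬝ᵥ ((ridgeGram fun t => ψ (z t))⁻¹ *ᵥ x)) * (c * √F.card + b) := by
  rw [ridge_error_eq]
  have h1 := dotProduct_ridgeGram_inv_self (fun t => ψ (z t)) x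
  set u := (ridgeGram fun t => ψ (z t))⁻¹ *ᵥ x
  set q := x ⬝ᵥ u
  set N : ι → ℝ := fun i => (Finset.univ.filter fun t => z t = i).card with hN
  have hu0 : 0 ≤ u ⬝ᵥ u := Finset.sum_nonneg fun t _ => mul_self_nonneg _
  have hS0 : 0 ≤ ∑ t, (ψ (z t) ⬝ᵥ u) ^ 2 := Finset.sum_nonneg fun t _ => sq_nonneg _
  -- Noise and bias are both controlled by `q = ∑ (ψ ⬝ᵥ u)² + u ⬝ᵥ u`: the noise by Cauchy–Schwarz
  -- over the points of `F`, the point `i` carrying the weight `√(N i)`, and the bias by the norm of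
  -- `u`.
  have hS : ∑ t, (ψ (z t) ⬝ᵥ u) ^ 2 = ∑ i ∈ F, (√(N i) * |ψ i ⬝ᵥ u|) ^ 2 := by
    rw [← Finset.sum_fiberwise_of_maps_to (fun t _ => hF t)]
    refine Finset.sum_congr rfl fun i _ => ?_
    rw [mul_pow, Real.sq_sqrt (Nat.cast_nonneg _), sq_abs,
      Finset.sum_congr rfl (g := fun _ => (ψ i ⬝ᵥ u) ^ 2) fun t ht => by
        rw [(Finset.mem_filter.1 ht).2], Finset.sum_const, nsmul_eq_mul]
  have hgroup : ∑ t, (ψ (z t) ⬝ᵥ u) * (y t - ψ (z t) ⬝ᵥ w)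
      = ∑ i ∈ F, (ψ i ⬝ᵥ u) * ∑ t, if z t = i then y t - ψ i ⬝ᵥ w else 0 := by
    rw [← Finset.sum_fiberwise_of_maps_to (fun t _ => hF t)]
    refine Finset.sum_congr rfl fun i _ => ?_
    rw [← Finset.sum_filter, Finset.mul_sum]
    exact Finset.sum_congr rfl fun t ht => by rw [(Finset.mem_filter.1 ht).2]
  have hmain : |∑ t, (ψ (z t) ⬝ᵥ u) * (y t - ψ (z t) ⬝ᵥ w)| ≤ c * √F.card * √q := by
    rw [hgroup]
    calc _ ≤ ∑ i ∈ F, c * (√(N i) * |ψ i ⬝ᵥ u|) := by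
          refine (Finset.abs_sum_le_sum_abs _ _).trans (Finset.sum_le_sum fun i hi => ?_)
          rw [abs_mul]
          refine (mul_le_mul_of_nonneg_left (hnoise i hi) (abs_nonneg _)).trans_eq ?_
          simp only [hN]
          ring
      _ = c * ∑ i ∈ F, √(N i) * |ψ i ⬝ᵥ u| := by rw [Finset.mul_sum]
      _ ≤ c * √(F.card * ∑ i ∈ F, (√(N i) * |ψ i ⬝ᵥ u|) ^ 2) := by
          gcongr
          exact Real.le_sqrt_of_sq_le sq_sum_le_card_mul_sum_sq
      _ ≤ c * √(F.card * q) := by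
          rw [← hS]
          gcongr
          linarith
      _ = c * √F.card * √q := by rw [Real.sqrt_mul (Nat.cast_nonneg _)]; ring
  have hbias : |u ⬝ᵥ w| ≤ √q * b :=
    (abs_dotProduct_le u w).trans (mul_le_mul (Real.sqrt_le_sqrt (by linarith)) hw
      (Real.sqrt_nonneg _) (Real.sqrt_nonneg _))
  calc _ ≤ _ := abs_sub _ _
    _ ≤ c * √F.card * √q + √q * b := add_le_add hmain hbias
    _ = _ := by ring

end Regression

/-! ### Summability of the features and linearity of the transitions -/

section LinearMixtureFeatures

variable {S : Type u} {A : Type v} {d : ℕ} {M : EpisodicMDP S A}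
  {φ : S → A → S → EuclideanSpace ℝ (Fin d)} {Cw : ℝ}

lemma IsLinearMixture.norm_sum_le (hM : IsLinearMixture M φ Cw) (s : S) (a : A) (F : Finset S) :
    ‖∑ s' ∈ F, φ s a s'‖ ≤ 1 := by
  classical
  have h1 := hM.norm_phiV_le (fun s' => if s' ∈ F then 1 else 0)
    (fun s' => by split_ifs <;> simp) s a
  rw [phiV, tsum_eq_sum (s := F) fun s' hs' => by simp [hs']] at h1
  rwa [Finset.sum_congr rfl fun s' hs' => by rw [if_pos hs', one_smul]] at h1

/-- Finite sums of a coordinate are at most `1` in absolute value. Applied to its nonnegative and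
its negative terms, this bounds the absolute sums by `2`. -/
lemma IsLinearMixture.summable_abs (hM : IsLinearMixture M φ Cw) (s : S) (a : A) (i : Fin d) :
    Summable fun s' => |φ s a s' i| := by
  classical
  refine summable_of_sum_le (c := 2) (fun _ => abs_nonneg _) fun F => ?_
  have hc : ∀ G : Finset S, |∑ s' ∈ G, φ s a s' i| ≤ 1 := by
    intro G
    refine le_trans ?_ (hM.norm_sum_le s a G)
    have := PiLp.norm_apply_le (∑ s' ∈ G, φ s a s') i
    simpa using this
  rw [← Finset.sum_filter_add_sum_filter_not F fun s' => 0 ≤ φ s a s' i]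
  have h1 : ∑ s' ∈ F.filter (fun s' => 0 ≤ φ s a s' i), |φ s a s' i| ≤ 1 := by
    rw [Finset.sum_congr rfl fun s' hs' => abs_of_nonneg (Finset.mem_filter.1 hs').2]
    exact (le_abs_self _).trans (hc _)
  have h2 : ∑ s' ∈ F.filter (fun s' => ¬ 0 ≤ φ s a s' i), |φ s a s' i| ≤ 1 := by
    rw [Finset.sum_congr rfl fun s' hs' =>
      abs_of_neg (not_le.1 (Finset.mem_filter.1 hs').2), Finset.sum_neg_distrib]
    exact (neg_le_abs _).trans (hc _)
  linarith

lemma IsLinearMixture.summable_smul (hM : IsLinearMixture M φ Cw) {V : S → ℝ} {c : ℝ}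
    (hV : ∀ s, |V s| ≤ c) (s : S) (a : A) : Summable fun s' => V s' • φ s a s' := by
  rw [← (EuclideanSpace.equiv (Fin d) ℝ).summable, Pi.summable]
  intro i
  refine Summable.of_norm_bounded ((hM.summable_abs s a i).mul_left c) fun s' => ?_
  simp only [map_smul, Pi.smul_apply, smul_eq_mul, Real.norm_eq_abs, abs_mul]
  exact mul_le_mul_of_nonneg_right (hV s') (abs_nonneg _)

/-- In a linear mixture MDP, expectations of the next value are linear in the parameter. -/
lemma phiV_dotProduct (hM : IsLinearMixture M φ Cw) {V : S → ℝ} {c : ℝ}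
    (hV : ∀ s, |V s| ≤ c) {h : ℕ} {w : EuclideanSpace ℝ (Fin d)}
    (hw : ∀ s a s', (M.P h s a s').toReal = inner ℝ (φ s a s') w) (s : S) (a : A) :
    (phiV φ V s a).ofLp ⬝ᵥ w.ofLp = M.nextExp h V s a := by
  have h1 : (phiV φ V s a).ofLp ⬝ᵥ w.ofLp = inner ℝ w (phiV φ V s a) := by
    rw [EuclideanSpace.inner_eq_star_dotProduct]
    simp
  rw [h1, phiV, ← innerSL_apply_apply (𝕜 := ℝ),
    (innerSL ℝ w).map_tsum (hM.summable_smul hV s a), EpisodicMDP.nextExp]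
  refine tsum_congr fun s' => ?_
  rw [innerSL_apply_apply, inner_smul_right, hw, real_inner_comm, mul_comm]

end LinearMixtureFeatures

/-! ### From one-step errors to gap-dependent sub-optimality -/

section Planning

variable {S : Type u} {A : Type v} {M : EpisodicMDP S A} {μ : Behaviour M} {π πs : Policy S A}

/-- `π` is greedy in the class of supported policies for the estimates `V` and `Q`, whose
one-step errors on the visited pairs are at most `ε`. -/
structure IsApproxGreedy (μ : Behaviour M) (ε : ℕ → ℝ) (V : ℕ → S → ℝ) (Q : ℕ → S → A → ℝ)
    (π : Policy S A) : Prop where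
  supports : μ.Supports π
  horizon : ∀ s, V M.H s = 0
  abs_V_le : ∀ h ≤ M.H, ∀ s, |V h s| ≤ M.H
  abs_Q_le : ∀ h < M.H, ∀ s a, |Q h s a| ≤ M.H
  greedy : ∀ h < M.H, ∀ s, M.Feasible h s → ∀ ν : PMF A, ν.support ⊆ μ.supp h s →
    actionExp ν (Q h s) ≤ actionExp (π h s) (Q h s)
  V_eq : ∀ h < M.H, ∀ s, V h s = actionExp (π h s) (Q h s)
  error_le : ∀ h < M.H, ∀ s a, μ.Visited h s → a ∈ μ.supp h s →
    |Q h s a - (M.r h s a + M.nextExp h (V (h + 1)) s a)| ≤ ε h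

/-- The accumulated one-step errors from stage `h` on. -/
def errorSum (H : ℕ) (ε : ℕ → ℝ) (h : ℕ) : ℝ := ∑ j ∈ Finset.Ico h H, ε j

lemma errorSum_eq {H h : ℕ} (ε : ℕ → ℝ) (hh : h < H) :
    errorSum H ε h = ε h + errorSum H ε (h + 1) :=
  Finset.sum_eq_sum_Ico_succ_bot hh ε

lemma errorSum_le_zero {H : ℕ} {ε : ℕ → ℝ} (hε : ∀ j, 0 ≤ ε j) (h : ℕ) :
    errorSum H ε h ≤ errorSum H ε 0 :=
  Finset.sum_le_sum_of_subset_of_nonneg (Finset.Ico_subset_Ico_left (Nat.zero_le h))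
    fun j _ _ => hε j

variable {ε : ℕ → ℝ} {V : ℕ → S → ℝ} {Q : ℕ → S → A → ℝ}

lemma Behaviour.Supports.mem_supp (hπ : μ.Supports π) {h : ℕ} (hh : h < M.H) {s : S}
    (hs : μ.Visited h s) {a : A} (ha : π h s a ≠ 0) : a ∈ μ.supp h s :=
  hπ h hh s hs.feasible ((PMF.mem_support_iff _ _).2 ha)

lemma abs_optValue_le (hs : M.IsOptimal πs) {h : ℕ} (hh : h ≤ M.H) (s : S) :
    |M.optValue h s| ≤ M.H := by
  rw [optValue_eq hs hh]
  exact abs_value_le πs h s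

/-- One step of the comparison of the estimates with a function `W` of the next state. -/
lemma IsApproxGreedy.abs_Q_sub_le (hg : IsApproxGreedy μ ε V Q π) {h : ℕ} (hh : h < M.H)
    {s : S} (hs : μ.Visited h s) {a : A} (ha : a ∈ μ.supp h s) {W : S → ℝ} {c : ℝ}
    (hW : ∀ s, |W s| ≤ c) {e : ℝ} (he : ∀ s', μ.Visited (h + 1) s' → |V (h + 1) s' - W s'| ≤ e) :
    |Q h s a - (M.r h s a + M.nextExp h W s a)| ≤ ε h + e := by
  have h1 := hg.error_le h hh s a hs ha
  have h2 : |M.nextExp h (V (h + 1)) s a - M.nextExp h W s a| ≤ e :=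
    abs_actionExp_sub_le (p := M.P h s a) (hg.abs_V_le (h + 1) hh) hW
      fun s' hs' => he s' (hs.succ ha hs')
  calc _ = |(Q h s a - (M.r h s a + M.nextExp h (V (h + 1)) s a))
        + (M.nextExp h (V (h + 1)) s a - M.nextExp h W s a)| := by ring_nf
    _ ≤ _ := (abs_add_le _ _).trans (add_le_add h1 h2)

/-- The estimated values are close to the optimal ones. -/
lemma IsApproxGreedy.abs_V_sub_optValue_le (hg : IsApproxGreedy μ ε V Q π) (ho : M.IsOptimal πs)
    (hsup : μ.Supports πs) (n : ℕ) : ∀ h, h + n = M.H → ∀ s, μ.Visited h s →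
      |V h s - M.optValue h s| ≤ errorSum M.H ε h := by
  induction n with
  | zero =>
    intro h hn s _
    obtain rfl : h = M.H := hn
    rw [hg.horizon, optValue_eq ho le_rfl, value_horizon]
    simp [errorSum]
  | succ n ih =>
    intro h hn s hs
    have hh : h < M.H := by omega
    have hQ : ∀ a ∈ μ.supp h s, |Q h s a - M.optQ h s a| ≤ errorSum M.H ε h := fun a ha => by
      rw [errorSum_eq ε hh]
      exact hg.abs_Q_sub_le hh hs ha (abs_optValue_le ho hh) (ih (h + 1) (by omega))
    rw [hg.V_eq h hh, abs_le]
    constructor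
    · have h1 := hg.greedy h hh s hs.feasible (πs h s) (hsup h hh s hs.feasible)
      have h2 := abs_actionExp_sub_le (p := πs h s) (hg.abs_Q_le h hh s) (abs_optQ_le ho hh s)
        fun a ha => hQ a (hsup.mem_supp hh hs ha)
      rw [← optValue_bellman ho hh, abs_le] at h2
      linarith
    · have h2 := abs_actionExp_sub_le (p := π h s) (hg.abs_Q_le h hh s) (abs_optQ_le ho hh s)
        fun a ha => hQ a (hg.supports.mem_supp hh hs ha)
      have h3 : actionExp (π h s) (M.optQ h s) ≤ M.optValue h s :=
        actionExp_le_of_le (abs_optQ_le ho hh s) fun a _ => optQ_le_optValue ho hh s a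
      linarith [(abs_le.1 h2).2]

/-- The estimated values are close to the values of the greedy policy. -/
lemma IsApproxGreedy.abs_V_sub_value_le (hg : IsApproxGreedy μ ε V Q π) (n : ℕ) :
    ∀ h, h + n = M.H → ∀ s, μ.Visited h s → |V h s - M.value π h s| ≤ errorSum M.H ε h := by
  induction n with
  | zero =>
    intro h hn s _
    obtain rfl : h = M.H := hn
    rw [hg.horizon, value_horizon]
    simp [errorSum]
  | succ n ih =>
    intro h hn s hs
    have hh : h < M.H := by omega
    rw [hg.V_eq h hh, value_succ π hh]
    refine abs_actionExp_sub_le (C' := (M.H : ℝ) + 1) (hg.abs_Q_le h hh s) (fun a => ?_)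
      fun a ha => ?_
    · have h1 := backup_mem (M := M) (h := h) (c := M.H) (V := M.value π (h + 1))
        (fun s => ⟨(value_mem π _ s).1, value_le_horizon π _ s⟩) s a
      exact abs_le_of_mem_zero_le h1.1 h1.2
    · rw [errorSum_eq ε hh]
      exact hg.abs_Q_sub_le hh hs (hg.supports.mem_supp hh hs ha) (abs_value_le π (h + 1))
        (ih (h + 1) (by omega))

/-- The greedy policy plays actions with small gaps. -/
lemma IsApproxGreedy.gap_le (hg : IsApproxGreedy μ ε V Q π) (ho : M.IsOptimal πs)
    (hsup : μ.Supports πs) {h : ℕ} (hh : h < M.H) {s : S} (hs : μ.Visited h s) {a : A}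
    (ha : π h s a ≠ 0) : M.gap h s a ≤ 2 * errorSum M.H ε h := by
  have ha' := hg.supports.mem_supp hh hs ha
  have hQ : |Q h s a - M.optQ h s a| ≤ errorSum M.H ε h := by
    rw [errorSum_eq ε hh]
    exact hg.abs_Q_sub_le hh hs ha' (abs_optValue_le ho hh)
      (hg.abs_V_sub_optValue_le ho hsup (M.H - (h + 1)) (h + 1) (by omega))
  have hV := hg.abs_V_sub_optValue_le ho hsup (M.H - h) h (by omega) s hs
  -- Point masses on the support of `π h s` are admissible competitors, so there `Q h s` never
  -- exceeds its mean `V h s` and must equal it.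
  have he : Q h s a = V h s := by
    rw [hg.V_eq h hh]
    refine eq_actionExp_of_le (hg.abs_Q_le h hh s) (fun x hx => ?_) ha
    rw [← actionExp_pure x (Q h s)]
    refine hg.greedy h hh s hs.feasible (PMF.pure x) ?_
    rw [PMF.support_pure, Set.singleton_subset_iff]
    exact hg.supports.mem_supp hh hs hx
  rw [he] at hQ
  rw [EpisodicMDP.gap]
  linarith [(abs_le.1 hQ).2, (abs_le.1 hV).1]

/-- If the errors are below the minimal gap, the greedy policy is optimal where it matters. -/
lemma IsApproxGreedy.value_eq_optValue (hg : IsApproxGreedy μ ε V Q π) (ho : M.IsOptimal πs)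
    (hsup : μ.Supports πs) (hε : ∀ j, 0 ≤ ε j) (hlt : 2 * errorSum M.H ε 0 < M.gapMin) (n : ℕ) :
    ∀ h, h + n = M.H → ∀ s, μ.Visited h s → M.value π h s = M.optValue h s := by
  induction n with
  | zero =>
    intro h hn s _
    obtain rfl : h = M.H := hn
    rw [optValue_eq ho le_rfl, value_horizon, value_horizon]
  | succ n ih =>
    intro h hn s hs
    have hh : h < M.H := by omega
    rw [value_succ π hh, ← actionExp_const (π h s) (M.optValue h s)]
    refine actionExp_congr fun a ha => ?_
    have ha' := hg.supports.mem_supp hh hs ha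
    have h0 : M.gap h s a = 0 := by
      by_contra hne
      have h1 := gapMin_le_gap ho hh hne
      have h2 := hg.gap_le ho hsup hh hs ha
      have h3 := errorSum_le_zero (H := M.H) hε h
      linarith
    have h1 : M.nextExp h (M.value π (h + 1)) s a = M.nextExp h (M.optValue (h + 1)) s a :=
      actionExp_congr fun s' hs' => ih (h + 1) (by omega) s' (hs.succ ha' hs')
    rw [h1]
    exact (sub_eq_zero.1 h0).symm

/-- Gap-dependent bound for the sub-optimality of the greedy policy. -/
lemma IsApproxGreedy.optValue_sub_value_le (hg : IsApproxGreedy μ ε V Q π) (ho : M.IsOptimal πs)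
    (hsup : μ.Supports πs) (hε : ∀ j, 0 ≤ ε j) (hgap : 0 < M.gapMin) {s : S}
    (hs : μ.Visited 0 s) :
    M.optValue 0 s - M.value π 0 s ≤ (2 * errorSum M.H ε 0) ^ 2 / M.gapMin := by
  -- Either every played gap vanishes, or `1 ≤ 2e/Δ_min`, which turns the linear bound `2e` into a
  -- quadratic one.
  by_cases hlt : 2 * errorSum M.H ε 0 < M.gapMin
  · rw [hg.value_eq_optValue ho hsup hε hlt M.H 0 (zero_add _) s hs, sub_self]
    positivity
  · rw [not_lt] at hlt
    have h1 := hg.abs_V_sub_optValue_le ho hsup M.H 0 (zero_add _) s hs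
    have h2 := hg.abs_V_sub_value_le M.H 0 (zero_add _) s hs
    have h3 : M.optValue 0 s - M.value π 0 s ≤ 2 * errorSum M.H ε 0 := by
      linarith [(abs_le.1 h1).1, (abs_le.1 h2).2]
    refine h3.trans ?_
    rw [le_div_iff₀ hgap, sq]
    exact mul_le_mul_of_nonneg_left hlt (hgap.le.trans hlt)

end Planning

/-! ### One-step errors of the algorithm on typical data -/

section Estimation

variable {S : Type u} {A : Type v} {d : ℕ} {M : EpisodicMDP S A} {μ : Behaviour M}
  {φ : S → A → S → EuclideanSpace ℝ (Fin d)} {Cw : ℝ} {n : ℕ} {D : Fin n → M.Traj}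

lemma qHat_mem (φ : S → A → S → EuclideanSpace ℝ (Fin d)) (lam b : ℝ) (D : Fin n → M.Traj)
    (h : Fin M.H) (V : S → ℝ) (s : S) (a : A) :
    qHat φ lam b D h V s a ∈ Set.Icc (0 : ℝ) (M.H - (h : ℕ)) := by
  have hh : ((h : ℕ) : ℝ) ≤ M.H := by exact_mod_cast h.isLt.le
  exact ⟨le_max_left _ _, max_le (by linarith) (min_le_right _ _)⟩

/-- Clipping to `[0, c]` is 1-Lipschitz and fixes `y`. -/
lemma abs_clip_sub_le {x y c : ℝ} (h0 : 0 ≤ y) (h1 : y ≤ c) : |max 0 (min x c) - y| ≤ |x - y| := by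
  have e : y = max 0 (min y c) := by rw [min_eq_left h1, max_eq_right h0]
  calc |max 0 (min x c) - y| = |max 0 (min x c) - max 0 (min y c)| := by rw [← e]
    _ ≤ |min x c - min y c| := by
        simpa using abs_max_sub_max_le_max 0 (min x c) 0 (min y c)
    _ ≤ |x - y| := by simpa using abs_min_sub_min_le_max x c y c

lemma densityInf_inv_le_kappa (hpos : ∀ h < M.H, 0 < μ.densityInf h) {h : ℕ} (hh : h < M.H) :
    (μ.densityInf h)⁻¹ ≤ μ.kappa :=
  Finset.single_le_sum (f := fun h => (μ.densityInf h)⁻¹)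
    (fun j hj => inv_nonneg.2 (hpos j (Finset.mem_range.1 hj)).le) (Finset.mem_range.2 hh)

/-- The constant in the one-step error bounds. -/
def errorConst (H : ℕ) (κ L Cw b : ℝ) : ℝ := H * √(2 * (L + κ)) + Cw + b

/-- One-step error of the pessimistic estimate on typical data. -/
lemma Concentrated.abs_qHat_sub_le (hpos : ∀ h < M.H, 0 < μ.densityInf h)
    (hM : IsLinearMixture M φ Cw) {L b : ℝ} (hL : 0 < L) (hb : 0 ≤ b)
    (hD : Concentrated μ L D) (hn : 4 * L * μ.kappa ≤ n) {h : Fin M.H} {V : S → ℝ}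
    (hV : ∀ s, V s ∈ Set.Icc (0 : ℝ) ((M.H : ℝ) - ((h : ℕ) + 1)))
    {s : S} {a : A} (hs : μ.Visited h s) (ha : a ∈ μ.supp h s) :
    |qHat φ 1 b D h V s a - (M.r h s a + M.nextExp h V s a)|
      ≤ (μ.densityInf h)⁻¹ * (2 / √n * errorConst M.H μ.kappa L Cw b) := by
  classical
  obtain ⟨w, hw⟩ := hM.transition
  obtain ⟨hwn, hwP⟩ := hw h h.isLt
  have hCw : 0 ≤ Cw := (norm_nonneg _).trans hwn
  have hν := hpos h h.isLt
  set ν := μ.densityInf h with hνdef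
  set κ := μ.kappa with hκ
  have hκν : ν⁻¹ ≤ κ := densityInf_inv_le_kappa hpos h.isLt
  have hκ1 : 1 ≤ ν⁻¹ := Behaviour.one_le_inv_densityInf hν
  have hκ0 : 0 < κ := by linarith
  have hn0 : (0 : ℝ) < n := lt_of_lt_of_le (by positivity) hn
  have hVH : ∀ s, V s ∈ Set.Icc (0 : ℝ) M.H := fun s =>
    ⟨(hV s).1, (hV s).2.trans (by linarith [Nat.cast_nonneg (α := ℝ) (h : ℕ)])⟩
  have hVb : ∀ s, |V s| ≤ M.H := fun s => abs_le_of_mem_zero_le (hVH s).1 (hVH s).2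
  have hz : (s, a) ∈ μ.pairs h := (Behaviour.mem_pairs hν).2 ⟨hs, ha⟩
  set N := visits D h (s, a) with hN
  -- After the burn-in, subtracting `L` costs at most half of `nν/2`.
  have hNge : n * (ν / 4) ≤ N := by
    have h1 := hD.le_visits h (s, a) hz
    have h2 : L ≤ n * (ν / 4) := by
      have h3 : 4 * L * ν⁻¹ ≤ n := (mul_le_mul_of_nonneg_left hκν (by positivity)).trans hn
      rw [← div_eq_mul_inv, div_le_iff₀ hν] at h3
      linarith
    linarith
  have hN0 : (0 : ℝ) < N := lt_of_lt_of_le (by positivity) hNge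
  set ψ : S × A → Fin d → ℝ := fun z => (phiV φ V z.1 z.2).ofLp with hψ
  have hgram : gram φ 1 D h V = ridgeGram fun t => ψ (D t h) := rfl
  have hmean : ∀ z : S × A, ψ z ⬝ᵥ (w h).ofLp = M.nextExp h V z.1 z.2 := fun z =>
    phiV_dotProduct hM hVb hwP z.1 z.2
  have hwidth : invNorm (gram φ 1 D h V) (phiV φ V s a) ≤ √(ν⁻¹) * (2 / √n) := by
    have h1 := ridgeGram_inv_le_of_visits ψ (fun t => D t h) (s, a)
      (by exact_mod_cast hN0)
    have h2 : (N : ℝ)⁻¹ ≤ ν⁻¹ * (4 / n) := by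
      rw [inv_le_comm₀ hN0 (by positivity)]
      refine le_trans (le_of_eq ?_) hNge
      field_simp
    have h3 : √(ν⁻¹) * (2 / √n) = √(ν⁻¹ * (4 / n)) := by
      rw [Real.sqrt_mul (by positivity), Real.sqrt_div (by norm_num),
        show (4 : ℝ) = 2 ^ 2 by norm_num, Real.sqrt_sq (by norm_num)]
    rw [h3]
    exact Real.sqrt_le_sqrt (h1.trans h2)
  have hnoise : ∀ z ∈ μ.pairs h, |∑ t, if D t h = z then target D h V t - ψ z ⬝ᵥ (w h).ofLp else 0|
      ≤ M.H * √(2 * (L + κ)) * √((Finset.univ.filter fun t => D t h = z).card) := by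
    intro z hz
    rw [hmean]
    by_cases hh : (h : ℕ) + 1 < M.H
    · refine (hD.abs_deviation_le hpos hh hz hVH).trans ?_
      rw [mul_assoc (M.H : ℝ), ← Real.sqrt_mul (by positivity)]
      refine mul_le_mul_of_nonneg_left (Real.sqrt_le_sqrt ?_) (Nat.cast_nonneg _)
      have h1 : ((μ.states (h + 1)).card : ℝ) ≤ κ :=
        ((Nat.cast_le.2 Behaviour.card_states_le).trans
          (Behaviour.card_pairs_le (hpos _ hh))).trans (densityInf_inv_le_kappa hpos hh)
      have h2 : ((μ.states (h + 1)).card : ℝ) * Real.log 2 ≤ κ :=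
        (mul_le_of_le_one_right (Nat.cast_nonneg _) (by linarith [Real.log_two_lt_d9])).trans h1
      calc 2 * (visits D h z : ℝ) * (L + (μ.states (h + 1)).card * Real.log 2)
          ≤ 2 * (visits D h z : ℝ) * (L + κ) := by gcongr
        _ = 2 * (L + κ) * visits D h z := by ring
    -- At the last stage the range of `V` is `{0}`, so the regression has no noise.
    · have hV0 : ∀ s, V s = 0 := fun s => by
        have h1 := hV s
        have h2 : (M.H : ℝ) = (h : ℕ) + 1 := by
          have := h.isLt
          exact_mod_cast (by omega : M.H = (h : ℕ) + 1)
        rw [h2, sub_self] at h1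
        exact le_antisymm h1.2 h1.1
      have h0 : ∀ t, target D h V t - M.nextExp h V z.1 z.2 = 0 := fun t => by
        simp [target, hh, EpisodicMDP.nextExp, hV0]
      simp only [h0, ite_self, Finset.sum_const_zero, abs_zero]
      positivity
  have hwb : √((w h).ofLp ⬝ᵥ (w h).ofLp) ≤ Cw := by
    refine le_trans (le_of_eq ?_) hwn
    rw [EuclideanSpace.norm_eq]
    simp [dotProduct, sq]
  have hridge := abs_ridge_error_le ψ (fun t => D t h) (μ.pairs h)
    (fun t => (Behaviour.mem_pairs hν).2 (hD.visited t h)) (ψ (s, a)) (w h).ofLp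
    (target D h V) (c := M.H * √(2 * (L + κ))) (by positivity) hwb hnoise
  rw [hmean, ← hgram] at hridge
  set q := invNorm (gram φ 1 D h V) (phiV φ V s a) with hq
  have hq0 : 0 ≤ q := Real.sqrt_nonneg _
  -- The width contributes one factor `√κ_h` and the number of pairs another; together they give
  -- `κ_h`.
  have hcard : √((μ.pairs h).card) ≤ √(ν⁻¹) := Real.sqrt_le_sqrt (Behaviour.card_pairs_le hν)
  have hsq1 : 1 ≤ √(ν⁻¹) := Real.one_le_sqrt.2 hκ1
  have hback := backup_mem (M := M) (h := h) (c := (M.H : ℝ) - ((h : ℕ) + 1)) hV s a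
  refine (abs_clip_sub_le hback.1 (hback.2.trans_eq (by ring))).trans ?_
  have hE : |(phiV φ V s a).ofLp ⬝ᵥ ridge φ 1 D h V - M.nextExp h V s a|
      ≤ q * (M.H * √(2 * (L + κ)) * √(μ.pairs h).card + Cw) := hridge
  have hbq : |b * q| = q * b := by rw [abs_of_nonneg (by positivity), mul_comm]
  calc |M.r h s a + (phiV φ V s a).ofLp ⬝ᵥ ridge φ 1 D h V - b * q
        - (M.r h s a + M.nextExp h V s a)|
      = |((phiV φ V s a).ofLp ⬝ᵥ ridge φ 1 D h V - M.nextExp h V s a) - b * q| := by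
        congr 1
        ring
    _ ≤ q * (M.H * √(2 * (L + κ)) * √(μ.pairs h).card + Cw) + q * b :=
        (abs_sub _ _).trans (add_le_add hE hbq.le)
    _ = q * (M.H * √(2 * (L + κ)) * √(μ.pairs h).card + (Cw + b)) := by ring
    _ ≤ (√(ν⁻¹) * (2 / √n)) * (M.H * √(2 * (L + κ)) * √(ν⁻¹) + (Cw + b) * √(ν⁻¹)) := by
        gcongr
        exact le_mul_of_one_le_right (by positivity) hsq1
    _ = (√(ν⁻¹) * √(ν⁻¹)) * (2 / √n * errorConst M.H κ L Cw b) := by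
        rw [errorConst]
        ring
    _ = ν⁻¹ * (2 / √n * errorConst M.H κ L Cw b) := by
        rw [Real.mul_self_sqrt (by positivity)]

/-- On typical data, the algorithm is approximately greedy. -/
lemma Concentrated.isApproxGreedy (hpos : ∀ h < M.H, 0 < μ.densityInf h)
    (hM : IsLinearMixture M φ Cw) {L b : ℝ} (hL : 0 < L) (hb : 0 ≤ b)
    (hD : Concentrated μ L D) (hn : 4 * L * μ.kappa ≤ n) {π : Policy S A}
    (hπ : IsBCPVTROutput μ φ 1 b D π) :
    ∃ V Q, IsApproxGreedy μ
      (fun h => |(μ.densityInf h)⁻¹| * (2 / √n * |errorConst M.H μ.kappa L Cw b|)) V Q π := by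
  obtain ⟨hsup, V, hV0, hV⟩ := hπ
  have hq : ∀ (h : Fin M.H) (V : S → ℝ) s a, |qHat φ 1 b D h V s a| ≤ (M.H : ℝ) - (h : ℕ) :=
    fun h V s a => abs_le_of_mem_zero_le (qHat_mem φ 1 b D h V s a).1 (qHat_mem φ 1 b D h V s a).2
  have hVm : ∀ h ≤ M.H, ∀ s, V h s ∈ Set.Icc (0 : ℝ) ((M.H : ℝ) - h) := by
    intro h hh s
    rcases hh.lt_or_eq with h1 | rfl
    · rw [(hV ⟨h, h1⟩).2 s]
      exact ⟨le_actionExp_of_le (hq _ _ s) fun a _ => (qHat_mem φ 1 b D ⟨h, h1⟩ _ s a).1,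
        actionExp_le_of_le (hq _ _ s) fun a _ => (qHat_mem φ 1 b D ⟨h, h1⟩ _ s a).2⟩
    · simp [hV0]
  refine ⟨V, fun h => if hh : h < M.H then qHat φ 1 b D ⟨h, hh⟩ (V (h + 1)) else 0,
    hsup, hV0, ?_, ?_, ?_, ?_, ?_⟩
  · intro h hh s
    exact abs_le_of_mem_zero_le (hVm h hh s).1
      ((hVm h hh s).2.trans (sub_le_self _ (Nat.cast_nonneg _)))
  · intro h hh s a
    simp only [dif_pos hh]
    exact (hq ⟨h, hh⟩ _ s a).trans (sub_le_self _ (Nat.cast_nonneg _))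
  · intro h hh s hs ν hν
    simp only [dif_pos hh]
    exact (hV ⟨h, hh⟩).1 s hs ν hν
  · intro h hh s
    simp only [dif_pos hh]
    exact (hV ⟨h, hh⟩).2 s
  · intro h hh s a hs ha
    simp only [dif_pos hh]
    refine (hD.abs_qHat_sub_le hpos hM hL hb hn (h := ⟨h, hh⟩) (fun s => ?_) hs ha).trans ?_
    · have h1 := hVm (h + 1) hh s
      push_cast at h1
      exact h1
    -- The absolute values make the error function nonnegative at every index without side
    -- conditions, including indices beyond the horizon.
    · refine (le_abs_self _).trans_eq ?_
      rw [abs_mul, abs_mul, abs_of_nonneg (show (0 : ℝ) ≤ 2 / √n by positivity)]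

end Estimation

/-! ### Summation over the iterations and comparison of constants -/

section FinalBound

/-- The summand at `k = 0` is `0⁻¹ = 0`. -/
lemma sum_range_inv_le {K : ℕ} (hK : 0 < K) :
    ∑ k ∈ Finset.range K, ((k : ℝ))⁻¹ ≤ 1 + Real.log K := by
  obtain ⟨m, rfl⟩ := Nat.exists_eq_succ_of_ne_zero hK.ne'
  rw [Finset.sum_range_succ']
  have h1 := harmonic_le_one_add_log m
  rw [harmonic] at h1
  push_cast at h1 ⊢
  have h2 : Real.log m ≤ Real.log (m + 1) := by
    rcases Nat.eq_zero_or_pos m with rfl | hm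
    · simp
    · exact Real.log_le_log (by exact_mod_cast hm) (by linarith)
  simp only [inv_zero, add_zero]
  linarith

/-- Summation of bounds which decay like `1 / k` after a burn-in of length `y`. -/
lemma sum_le_of_burn_in {K : ℕ} (hK : 0 < K) {f : Fin K → ℝ} {y B X : ℝ} (hy : 0 ≤ y)
    (hB : 0 ≤ B) (hX : 0 ≤ X) (h1 : ∀ k, f k ≤ B)
    (h2 : ∀ k : Fin K, y ≤ (k : ℕ) → f k ≤ X * ((k : ℕ) : ℝ)⁻¹) :
    ∑ k, f k ≤ B * (y + 1) + X * (1 + Real.log K) := by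
  classical
  have h3 : ∀ k : Fin K, f k ≤ (if ((k : ℕ) : ℝ) < y then B else 0) + X * ((k : ℕ) : ℝ)⁻¹ := by
    intro k
    split_ifs with hk
    · exact (h1 k).trans (le_add_of_nonneg_right (by positivity))
    · rw [zero_add]
      exact h2 k (not_lt.1 hk)
  refine (Finset.sum_le_sum fun k _ => h3 k).trans ?_
  rw [Finset.sum_add_distrib, ← Finset.mul_sum,
    Fin.sum_univ_eq_sum_range (fun k => ((k : ℝ))⁻¹),
    Fin.sum_univ_eq_sum_range (fun k => if (k : ℝ) < y then B else 0)]
  refine add_le_add ?_ (mul_le_mul_of_nonneg_left (sum_range_inv_le hK) hX)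
  rw [← Finset.sum_filter, Finset.sum_const, nsmul_eq_mul, mul_comm]
  refine mul_le_mul_of_nonneg_left ?_ hB
  have hsub : (Finset.range K).filter (fun k : ℕ => (k : ℝ) < y) ⊆ Finset.range ⌈y⌉₊ :=
    fun k hk => Finset.mem_range.2 (Nat.lt_ceil.2 (Finset.mem_filter.1 hk).2)
  have hcard := Finset.card_le_card hsub
  rw [Finset.card_range] at hcard
  exact (Nat.cast_le.2 hcard).trans (Nat.ceil_lt_add_one hy).le

/-- For `y ≥ 2` the factor `2` is absorbed by one more power of `y`. -/
lemma log_two_mul_pow_three_le {x y : ℝ} (hy : 2 ≤ y) (hx0 : 0 < x) (hx : x ≤ 2 * y ^ 3) :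
    Real.log x ≤ 4 * Real.log y := by
  have h1 := Real.log_le_log hx0 hx
  have h2 := Real.log_le_log two_pos hy
  rw [Real.log_mul two_ne_zero (by positivity), Real.log_pow] at h1
  push_cast at h1
  linarith

lemma half_le_log {y : ℝ} (hy : 2 ≤ y) : 1 / 2 ≤ Real.log y := by
  have h2 := Real.log_le_log two_pos hy
  linarith [Real.log_two_gt_d9]

/-- Elementary bound for the squared constant in the one-step errors. -/
lemma errorConst_sq_le {H : ℕ} {d κ L L1 b Cw Λ : ℝ} (hH : 1 ≤ H) (hd : 1 ≤ d) (hκ : 1 ≤ κ)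
    (hL0 : 0 ≤ L) (hL : L ≤ 4 * Λ) (hL1 : L1 ≤ 4 * Λ) (hΛ : 1 / 2 ≤ Λ) (hCw : 0 ≤ Cw)
    (hb : b ≤ H * √(d * L1) + Cw) (hb0 : 0 ≤ b) :
    errorConst H κ L Cw b ^ 2 ≤ H ^ 2 * κ * d * Λ * (48 + 24 * Cw ^ 2) := by
  have hH' : (1 : ℝ) ≤ H := by exact_mod_cast hH
  set u := (H : ℝ) * √(2 * (L + κ)) with hu
  set v := (H : ℝ) * √(d * (4 * Λ)) with hv
  have hu0 : 0 ≤ u := by positivity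
  have hv0 : 0 ≤ v := by positivity
  have hu2 : u ^ 2 = H ^ 2 * (2 * (L + κ)) := by
    rw [hu, mul_pow, Real.sq_sqrt (by positivity)]
  have hv2 : v ^ 2 = H ^ 2 * (d * (4 * Λ)) := by
    rw [hv, mul_pow, Real.sq_sqrt (by positivity)]
  have hbv : b ≤ v + Cw := by
    refine hb.trans ?_
    rw [hv]
    gcongr
  have h1 : errorConst H κ L Cw b ^ 2 ≤ 3 * (u ^ 2 + 4 * Cw ^ 2 + v ^ 2) := by
    have h2 : errorConst H κ L Cw b ≤ u + 2 * Cw + v := by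
      rw [errorConst]
      linarith
    have h3 : 0 ≤ errorConst H κ L Cw b := by
      rw [errorConst]
      positivity
    refine (pow_le_pow_left₀ h3 h2 2).trans ?_
    nlinarith [sq_nonneg (u - 2 * Cw), sq_nonneg (u - v), sq_nonneg (2 * Cw - v)]
  refine h1.trans ?_
  rw [hu2, hv2]
  -- All summands are compared with `κ d Λ`, using `κ, d ≥ 1` and `Λ ≥ 1/2`. The constants arise as
  -- `48 = 3 · (12 + 4)` and `24 = 3 · 4 · 2`.
  have e1 : L ≤ 4 * (κ * d * Λ) := by
    have : 1 * 1 * Λ ≤ κ * d * Λ := by gcongr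
    linarith
  have e2 : κ ≤ 2 * (κ * d * Λ) := by
    have : κ * 1 * (1 / 2) ≤ κ * d * Λ := by gcongr
    linarith
  have e3 : d * (4 * Λ) ≤ 4 * (κ * d * Λ) := by
    have : 1 * (d * Λ) ≤ κ * (d * Λ) := by gcongr
    linarith
  have e4 : Cw ^ 2 ≤ 2 * (H ^ 2 * κ * d * Λ) * Cw ^ 2 := by
    have : (1 : ℝ) ^ 2 * 1 * 1 * (1 / 2) ≤ H ^ 2 * κ * d * Λ := by gcongr
    nlinarith [sq_nonneg Cw]
  have f1 : (H : ℝ) ^ 2 * (2 * (L + κ)) ≤ H ^ 2 * (12 * (κ * d * Λ)) :=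
    mul_le_mul_of_nonneg_left (by linarith) (sq_nonneg _)
  have f2 := mul_le_mul_of_nonneg_left e3 (sq_nonneg (H : ℝ))
  linarith

/-- The total bound, in terms of the quantities of the theorem. -/
lemma total_bound {H d κ Δ L Λ lK Cw : ℝ} (hH : 1 ≤ H) (hd : 1 ≤ d) (hκ : 1 ≤ κ) (hΔ : 0 < Δ)
    (hΔH : Δ ≤ H) (hL : L ≤ 4 * Λ) (hlK0 : 0 ≤ lK)
    (hlK : lK ≤ Λ) (hΛ : 1 / 2 ≤ Λ) :
    H * (4 * L * κ + 1) + 16 * κ ^ 2 * (H ^ 2 * κ * d * Λ * (48 + 24 * Cw ^ 2)) / Δ * (1 + lK)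
      ≤ 100 * (48 + 24 * Cw ^ 2) * (2 * (d ^ 2 * H ^ 2 * κ ^ 3 / Δ) * Λ ^ 3) := by
  have hG : 48 ≤ 48 + 24 * Cw ^ 2 := by nlinarith [sq_nonneg Cw]
  generalize 48 + 24 * Cw ^ 2 = G at *
  -- Both terms are compared with `T κ³ d² Λ³`, `T = H²/Δ`; `Λ ≥ 1/2` allows lower powers of `Λ` to
  -- be raised to the third. The burn-in costs at most `2G` of these and the main term `96G`, out of
  -- `200G`.
  have hΛ3 : Λ ≤ 4 * Λ ^ 3 := by nlinarith [mul_nonneg (by linarith : 0 ≤ Λ) (by linarith : 0 ≤ Λ - 1 / 2)]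
  have hΛ2 : Λ ^ 2 ≤ 2 * Λ ^ 3 := by nlinarith [sq_nonneg Λ]
  have hΛ0 : 0 < Λ := by linarith
  have hq : H ≤ H ^ 2 / Δ := by
    rw [le_div_iff₀ hΔ, sq]
    gcongr
  have hκ3 : κ ≤ κ ^ 3 := by nlinarith [mul_nonneg (by linarith : 0 ≤ κ) (by linarith : 0 ≤ κ - 1)]
  have hd2 : d ≤ d ^ 2 := by nlinarith
  set T := H ^ 2 / Δ with hT
  have hT0 : 0 < T := by positivity
  have a1 : H * (4 * L * κ + 1) ≤ T * (18 * (κ ^ 3 * d ^ 2 * (4 * Λ ^ 3))) := by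
    have b1 : 4 * L * κ + 1 ≤ 18 * (κ * Λ) := by
      have c1 : L * κ ≤ 4 * Λ * κ := by gcongr
      have c2 : 1 * (1 / 2) ≤ κ * Λ := by gcongr
      linarith
    have b2 : κ * Λ ≤ κ ^ 3 * d ^ 2 * (4 * Λ ^ 3) := by
      have c1 : κ * 1 ≤ κ ^ 3 * d ^ 2 := by
        gcongr
        exact one_le_pow₀ hd
      calc κ * Λ = κ * 1 * Λ := by ring
        _ ≤ κ ^ 3 * d ^ 2 * (4 * Λ ^ 3) := by gcongr
    calc H * (4 * L * κ + 1) ≤ H * (18 * (κ ^ 3 * d ^ 2 * (4 * Λ ^ 3))) := by gcongr; linarith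
      _ ≤ _ := by gcongr
  have a2 : 16 * κ ^ 2 * (H ^ 2 * κ * d * Λ * G) / Δ * (1 + lK)
      ≤ 48 * (κ ^ 3 * d ^ 2 * T * G * (2 * Λ ^ 3)) := by
    calc 16 * κ ^ 2 * (H ^ 2 * κ * d * Λ * G) / Δ * (1 + lK)
        = 16 * (κ ^ 3 * d * T * G * Λ) * (1 + lK) := by rw [hT]; ring
      _ ≤ 16 * (κ ^ 3 * d ^ 2 * T * G * Λ) * (3 * Λ) := by gcongr; linarith
      _ = 48 * (κ ^ 3 * d ^ 2 * T * G * Λ ^ 2) := by ring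
      _ ≤ _ := by gcongr
  have a3 : T * (18 * (κ ^ 3 * d ^ 2 * (4 * Λ ^ 3))) ≤ 2 * G * (T * κ ^ 3 * d ^ 2 * Λ ^ 3) := by
    have : 0 ≤ T * κ ^ 3 * d ^ 2 * Λ ^ 3 := by positivity
    nlinarith
  have e : 100 * G * (2 * (d ^ 2 * H ^ 2 * κ ^ 3 / Δ) * Λ ^ 3)
      = 200 * G * (T * κ ^ 3 * d ^ 2 * Λ ^ 3) := by rw [hT]; ring
  rw [e]
  have hp : 0 ≤ G * (T * κ ^ 3 * d ^ 2 * Λ ^ 3) := by positivity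
  linarith

variable {S : Type u} {A : Type v} {M : EpisodicMDP S A} {μ : Behaviour M} {πs : Policy S A}

/-- A bound for the sub-optimality of a mixture from bounds for its components. -/
lemma subOptMix_le {K : ℕ} (hK : 0 < K) (ho : M.IsOptimal πs) {π : Fin K → Policy S A} {T : ℝ}
    (h : ∀ s, μ.Visited 0 s → ∑ k, (M.optValue 0 s - M.value (π k) 0 s) ≤ T) :
    M.subOptMix π ≤ T / K := by
  have hK' : (0 : ℝ) < K := by exact_mod_cast hK
  have e : ∀ s, M.optValue 0 s - (1 / (K : ℝ)) * ∑ k, M.value (π k) 0 s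
      = (∑ k, (M.optValue 0 s - M.value (π k) 0 s)) / K := by
    intro s
    rw [Finset.sum_sub_distrib, Finset.sum_const, Finset.card_univ, Fintype.card_fin,
      nsmul_eq_mul]
    field_simp
  have hb : ∀ s, |M.optValue 0 s - (1 / (K : ℝ)) * ∑ k, M.value (π k) 0 s|
      ≤ M.H + (1 / (K : ℝ)) * ∑ _k : Fin K, (M.H : ℝ) := by
    intro s
    refine (abs_sub _ _).trans (add_le_add (abs_optValue_le ho (Nat.zero_le _) s) ?_)
    rw [abs_mul, abs_of_nonneg (by positivity)]
    gcongr
    exact (Finset.abs_sum_le_sum_abs _ _).trans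
      (Finset.sum_le_sum fun k _ => abs_value_le (π k) 0 s)
  refine actionExp_le_of_le (p := M.init) hb fun s hs => ?_
  rw [e]
  gcongr
  exact h s hs

lemma optValue_sub_value_le_horizon (ho : M.IsOptimal πs) (π : Policy S A) (s : S) :
    M.optValue 0 s - M.value π 0 s ≤ M.H := by
  have h1 := value_le_horizon (M := M) πs 0 s
  rw [← optValue_eq ho (Nat.zero_le _)] at h1
  linarith [(value_mem (M := M) π 0 s).1]

lemma errorSum_eq_kappa_mul (hpos : ∀ h < M.H, 0 < μ.densityInf h) (c : ℝ) :
    errorSum M.H (fun h => |(μ.densityInf h)⁻¹| * c) 0 = μ.kappa * c := by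
  rw [errorSum, Behaviour.kappa, Finset.sum_mul, Finset.range_eq_Ico]
  refine Finset.sum_congr rfl fun h hh => ?_
  rw [abs_of_nonneg (inv_nonneg.2 (hpos h (Finset.mem_Ico.1 hh).2).le)]

variable {d : ℕ} {φ : S → A → S → EuclideanSpace ℝ (Fin d)} {Cw : ℝ}

lemma betaVTR_le {H d k K : ℕ} {δ : ℝ} (hH : 1 ≤ H) (hk : k ≤ K) (hδ : 0 < δ) (Cw : ℝ) :
    betaVTR H d 1 Cw δ k ≤ H * √(d * Real.log ((H + K * (H : ℝ) ^ 3) / δ)) + Cw := by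
  have hH' : (0 : ℝ) < H := by exact_mod_cast hH
  have hk' : (k : ℝ) ≤ K := by exact_mod_cast hk
  rw [betaVTR, Real.sqrt_one, one_mul, div_one]
  gcongr

lemma betaVTR_nonneg {Cw : ℝ} (hCw : 0 ≤ Cw) (H d k : ℕ) (δ : ℝ) :
    0 ≤ betaVTR H d 1 Cw δ k := by
  rw [betaVTR, Real.sqrt_one, one_mul]
  positivity

/-- Sub-optimality of the policy computed from one typical data set. -/
lemma Concentrated.optValue_sub_value_le (hpos : ∀ h < M.H, 0 < μ.densityInf h)
    (hM : IsLinearMixture M φ Cw) {L b : ℝ} (hL : 0 < L) (hb : 0 ≤ b) {n : ℕ}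
    {D : Fin n → M.Traj} (hD : Concentrated μ L D) (hn : 4 * L * μ.kappa ≤ n) {π : Policy S A}
    (hπ : IsBCPVTROutput μ φ 1 b D π) (ho : M.IsOptimal πs) (hsup : μ.Supports πs)
    (hgap : 0 < M.gapMin) {s : S} (hs : μ.Visited 0 s) :
    M.optValue 0 s - M.value π 0 s
      ≤ 16 * μ.kappa ^ 2 * errorConst M.H μ.kappa L Cw b ^ 2 / M.gapMin * (n : ℝ)⁻¹ := by
  obtain ⟨V, Q, hg⟩ := hD.isApproxGreedy hpos hM hL hb hn hπ
  refine (hg.optValue_sub_value_le ho hsup (fun j => by positivity) hgap hs).trans_eq ?_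
  rw [errorSum_eq_kappa_mul hpos, mul_pow, mul_pow, mul_pow, sq_abs, div_pow,
    Real.sq_sqrt (Nat.cast_nonneg n)]
  ring

/-- The deterministic part of the analysis. -/
lemma subOptMix_le_of_concentrated (hpos : ∀ h < M.H, 0 < μ.densityInf h)
    (hM : IsLinearMixture M φ Cw) (hCw : 0 ≤ Cw) (hH : 1 ≤ M.H) (hd : 1 ≤ d)
    (hκ : 1 ≤ μ.kappa) (ho : M.IsOptimal πs) (hsup : μ.Supports πs) (hgap : 0 < M.gapMin)
    {K : ℕ} (hK : 0 < K) {δ : ℝ} (hδ : 0 < δ) (hδ1 : δ ≤ 1)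
    {πhat : (k : ℕ) → (Fin k → M.Traj) → Policy S A}
    (hπ : ∀ k < K, ∀ D : Fin k → M.Traj,
      IsBCPVTROutput μ φ 1 (betaVTR M.H d 1 Cw δ (k + 1)) D (πhat k D))
    {D : Fin K → M.Traj}
    (hD : ∀ k : Fin K, Concentrated μ (Real.log (2 * μ.kappa * K ^ 2 / δ)) (firstEpisodes D k)) :
    M.subOptMix (fun k : Fin K => πhat k (firstEpisodes D k)) ≤
      100 * (48 + 24 * Cw ^ 2) * (2 * ((d : ℝ) ^ 2 * (M.H : ℝ) ^ 2 * μ.kappa ^ 3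
        / (M.gapMin * K)) * Real.log (d * K * M.H / δ) ^ 3) + 2 / K := by
  set κ := μ.kappa
  set Δ := M.gapMin
  have hK1 : (1 : ℝ) ≤ K := by exact_mod_cast hK
  have hd1 : (1 : ℝ) ≤ d := by exact_mod_cast hd
  have hH1 : (1 : ℝ) ≤ M.H := by exact_mod_cast hH
  have hΔH : Δ ≤ M.H := gapMin_le_horizon ho hgap
  have hδi : 1 ≤ 1 / δ := by rwa [le_div_iff₀ hδ, one_mul]
  set y : ℝ := d * K * M.H / δ with hy
  have hy1 : (d : ℝ) * K * M.H ≤ y := by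
    rw [hy, le_div_iff₀ hδ]
    exact mul_le_of_le_one_right (by positivity) hδ1
  have hdKH : (1 : ℝ) ≤ d * K * M.H := by
    calc (1 : ℝ) = 1 * 1 * 1 := by norm_num
      _ ≤ d * K * M.H := by gcongr
  have hΛ0 : 0 ≤ Real.log y := Real.log_nonneg (hdKH.trans hy1)
  have hlead : 0 ≤ 100 * (48 + 24 * Cw ^ 2) * (2 * ((d : ℝ) ^ 2 * (M.H : ℝ) ^ 2 * κ ^ 3
      / (Δ * K)) * Real.log y ^ 3) := by positivity
  have htriv : M.subOptMix (fun k : Fin K => πhat k (firstEpisodes D k)) ≤ M.H := by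
    refine (subOptMix_le (μ := μ) hK ho (T := K * M.H) fun s _ => ?_).trans_eq (by field_simp)
    refine (Finset.sum_le_sum fun k _ => optValue_sub_value_le_horizon ho _ s).trans_eq ?_
    simp
  -- If `dKH/δ < 2`, then `K = H = 1`; the logarithm may vanish, but `2/K = 2` exceeds the trivial
  -- bound `H`.
  rcases lt_or_ge y 2 with hlt | hy2
  · have h1 : d * K * M.H < 2 := by exact_mod_cast hy1.trans_lt hlt
    have hd' : d ≤ d * K * M.H := by nlinarith [Nat.mul_le_mul hK hH, Nat.zero_le d]
    have hKH : M.H = 1 ∧ K = 1 := by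
      have a1 : K * M.H ≤ d * K * M.H := by nlinarith [Nat.mul_le_mul hK hH]
      have a2 : K ≤ K * M.H := Nat.le_mul_of_pos_right _ hH
      have a3 : M.H ≤ K * M.H := Nat.le_mul_of_pos_left _ hK
      omega
    refine htriv.trans ?_
    rw [hKH.2] at hlead ⊢
    rw [hKH.1] at hlead ⊢
    push_cast at hlead ⊢
    linarith
  have hΛ := half_le_log hy2
  set Λ := Real.log y with hΛdef
  have hscale : 100 * (48 + 24 * Cw ^ 2) * (2 * ((d : ℝ) ^ 2 * (M.H : ℝ) ^ 2 * κ ^ 3 / (Δ * K))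
      * Λ ^ 3) = 100 * (48 + 24 * Cw ^ 2) * (2 * ((d : ℝ) ^ 2 * (M.H : ℝ) ^ 2 * κ ^ 3 / Δ)
      * Λ ^ 3) / K := by
    field_simp
  refine le_add_of_le_of_nonneg ?_ (by positivity)
  -- If `K < κ`, then `κ³/K ≥ 1` and the leading term exceeds `H`. Otherwise `κ ≤ K ≤ y`, so the `κ`
  -- inside `L` is absorbed by `log y`.
  rcases lt_or_ge (K : ℝ) κ with hκK | hκK
  · refine htriv.trans ?_
    have h1 : (M.H : ℝ) ≤ M.H ^ 2 / Δ := by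
      rw [le_div_iff₀ hgap, sq]
      gcongr
    have h2 : (1 : ℝ) ≤ κ ^ 3 / K := by
      rw [one_le_div (by positivity)]
      exact hκK.le.trans (le_self_pow₀ hκ three_ne_zero)
    have h3 : (1 / 2 : ℝ) ^ 3 ≤ Λ ^ 3 := by gcongr
    have h4 : (1 : ℝ) ≤ d ^ 2 := one_le_pow₀ hd1
    calc (M.H : ℝ) = 100 * (48 + 24 * 0 ^ 2) * (2 * (1 * M.H * 1) * (1 / 2) ^ 3) / 1200 := by ring
      _ ≤ 100 * (48 + 24 * 0 ^ 2) * (2 * (1 * M.H * 1) * (1 / 2) ^ 3) := by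
          rw [div_le_iff₀ (by norm_num)]
          linarith
      _ ≤ 100 * (48 + 24 * Cw ^ 2) * (2 * (d ^ 2 * (M.H ^ 2 / Δ) * (κ ^ 3 / K)) * Λ ^ 3) := by
          gcongr
      _ = _ := by
          field_simp
  · have hlogL : Real.log (2 * κ * K ^ 2 / δ) ≤ 4 * Λ := by
      refine log_two_mul_pow_three_le hy2 (by positivity) ?_
      have h1 : (K : ℝ) ≤ d * K * M.H := by
        calc (K : ℝ) = 1 * K * 1 := by ring
          _ ≤ d * K * M.H := by gcongr
      calc 2 * κ * K ^ 2 / δ = 2 * (κ * K * (K / δ)) := by ring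
        _ ≤ 2 * (y * y * y) := by
            have h2 : κ ≤ y := hκK.trans (h1.trans hy1)
            have h3 : (K : ℝ) ≤ y := h1.trans hy1
            have h4 : (K : ℝ) / δ ≤ y := by rw [hy]; gcongr
            gcongr
        _ = 2 * y ^ 3 := by ring
    have hlogL1 : Real.log ((M.H + K * (M.H : ℝ) ^ 3) / δ) ≤ 4 * Λ := by
      refine log_two_mul_pow_three_le hy2 (by positivity) ?_
      have h1 : (M.H : ℝ) ≤ d * K * M.H := by
        calc (M.H : ℝ) = 1 * 1 * M.H := by ring
          _ ≤ d * K * M.H := by gcongr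
      have h5 : (K : ℝ) * M.H ≤ d * K * M.H := by
        calc (K : ℝ) * M.H = 1 * K * M.H := by ring
          _ ≤ d * K * M.H := by gcongr
      calc (M.H + K * (M.H : ℝ) ^ 3) / δ ≤ (K * (M.H : ℝ) ^ 3 + K * (M.H : ℝ) ^ 3) / δ := by
            gcongr
            calc (M.H : ℝ) = 1 * M.H ^ 1 := by ring
              _ ≤ K * (M.H : ℝ) ^ 3 := by
                  gcongr
                  norm_num
        _ = 2 * (M.H * M.H * (K * M.H / δ)) := by ring
        _ ≤ 2 * (y * y * y) := by
            have h3 : (M.H : ℝ) ≤ y := h1.trans hy1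
            have h4 : (K : ℝ) * M.H / δ ≤ y := by rw [hy]; gcongr
            gcongr
        _ = 2 * y ^ 3 := by ring
    have hlogK : Real.log K ≤ Λ := by
      refine Real.log_le_log (by positivity) (le_trans ?_ hy1)
      calc (K : ℝ) = 1 * K * 1 := by ring
        _ ≤ d * K * M.H := by gcongr
    set L := Real.log (2 * κ * K ^ 2 / δ) with hLdef
    have hL : 0 < L := by
      refine Real.log_pos ((lt_div_iff₀ hδ).2 ?_)
      have : (1 : ℝ) * 1 ≤ κ * K ^ 2 := by
        gcongr
        exact one_le_pow₀ hK1
      linarith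
    rw [hscale]
    refine (subOptMix_le (μ := μ) hK ho fun s hs => ?_).trans (div_le_div_of_nonneg_right
      (total_bound hH1 hd1 hκ hgap hΔH hlogL (Real.log_nonneg hK1) hlogK hΛ (Cw := Cw)) (by positivity))
    refine sum_le_of_burn_in hK (by positivity) (by positivity) (by positivity)
      (fun k => optValue_sub_value_le_horizon ho _ s) fun k hk => ?_
    refine ((hD k).optValue_sub_value_le hpos hM hL (betaVTR_nonneg hCw _ _ _ _) hk
      (hπ k k.isLt _) ho hsup hgap hs).trans ?_
    have hβ := betaVTR_le (d := d) hH (Nat.succ_le_of_lt k.isLt) hδ Cw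
    have hE := errorConst_sq_le hH hd1 hκ hL.le hlogL hlogL1 hΛ hCw hβ
      (betaVTR_nonneg hCw _ _ _ _)
    gcongr

end FinalBound

/-! ### Probability of typical data -/

section Probability

variable {S : Type u} {A : Type v} {M : EpisodicMDP S A} {μ : Behaviour M}

/-- The level `L` is chosen so that the union bound `2κK² exp(-L)` equals `δ`. -/
lemma ofReal_one_sub_le_measure_concentrated (hpos : ∀ h < M.H, 0 < μ.densityInf h)
    (hκ : 1 ≤ μ.kappa) {K : ℕ} (hK : 0 < K) {δ : ℝ} (hδ : 0 < δ) (hδ1 : δ ≤ 1) :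
    ENNReal.ofReal (1 - δ) ≤ (μ.dataLaw K).toOuterMeasure {D | ∀ k : Fin K,
      Concentrated μ (Real.log (2 * μ.kappa * K ^ 2 / δ)) (firstEpisodes D k)} := by
  have hK1 : (1 : ℝ) ≤ K := by exact_mod_cast hK
  have hc : 0 < 2 * μ.kappa * K ^ 2 / δ := by positivity
  have hL : 0 < Real.log (2 * μ.kappa * K ^ 2 / δ) := by
    refine Real.log_pos ((lt_div_iff₀ hδ).2 ?_)
    have : (1 : ℝ) * 1 ≤ μ.kappa * K ^ 2 := by
      gcongr
      exact one_le_pow₀ hK1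
    linarith
  rw [ENNReal.ofReal_sub _ hδ.le, ENNReal.ofReal_one]
  refine le_toOuterMeasure_of_compl_le _ _ ((measure_not_concentrated_le hpos K hL).trans_eq ?_)
  rw [Real.exp_neg, Real.exp_log hc]
  congr 1
  field_simp

end Probability

end OfflineRL

end

/-! ### The main theorem -/

theorem mainTheorem7 (Cw : ℝ) :
    ∃ C : ℝ, 0 < C ∧
      ∀ (S : Type u) (A : Type v) (M : OfflineRL.EpisodicMDP S A) (d : ℕ)
        (φ : S → A → S → EuclideanSpace ℝ (Fin d))
        (_ : OfflineRL.IsLinearMixture M φ Cw)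
        (μ : OfflineRL.Behaviour M)
        -- concentrability for an optimal policy in the support-constrained class
        (_ : ∃ πstar : OfflineRL.Policy S A,
          M.IsOptimal πstar ∧ μ.Covers πstar ∧ μ.Supports πstar)
        -- visitation probabilities bounded away from zero, positive minimal gap
        (_ : ∀ h < M.H, 0 < μ.densityInf h)
        (_ : 0 < M.gapMin)
        (K : ℕ) (δ : ℝ) (_ : 0 < δ) (_ : δ ≤ 1) (_ : 2 ≤ K * μ.kappa / δ)
        -- the policies computed by the algorithm from the first `k` episodes
        (πhat : (k : ℕ) → (Fin k → M.Traj) → OfflineRL.Policy S A)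
        (_ : ∀ k < K, ∀ D : Fin k → M.Traj,
          OfflineRL.IsBCPVTROutput μ φ 1 (OfflineRL.betaVTR M.H d 1 Cw δ (k + 1)) D (πhat k D)),
        ENNReal.ofReal (1 - (1 + 3 * Real.logb 2 (M.H / M.gapMin)) * δ) ≤
          (μ.dataLaw K).toOuterMeasure
            {D | M.subOptMix (fun k : Fin K => πhat k (OfflineRL.firstEpisodes D k)) ≤
              C * (2 * ((d : ℝ) ^ 2 * (M.H : ℝ) ^ 2 * μ.kappa ^ 3 / (M.gapMin * K))
                * Real.log (d * K * M.H / δ) ^ 3)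
              + 16 * μ.kappa / (3 * K) * Real.log (Real.logb 2 (K * μ.kappa / δ))
              + 2 / K} := by
  refine ⟨100 * (48 + 24 * Cw ^ 2), by positivity, ?_⟩
  intro S A M d φ hM μ hstar hpos hgap K δ hδ hδ1 hKκ πhat hπ
  obtain ⟨πs, ho, -, hsup⟩ := hstar
  -- With `H = 0` (an empty sum `κ`) or `K = 0`, the quantity `Kκ/δ` would be `0`.
  have hH : 1 ≤ M.H := by
    by_contra hH
    have h0 : M.H = 0 := by omega
    simp [OfflineRL.Behaviour.kappa, h0] at hKκ
    linarith
  have hK : 0 < K := by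
    rcases Nat.eq_zero_or_pos K with rfl | hK
    · simp at hKκ
      linarith
    · exact hK
  have hK0 : (0 : ℝ) < K := by exact_mod_cast hK
  have hκ : 1 ≤ μ.kappa := (OfflineRL.Behaviour.one_le_inv_densityInf (hpos 0 hH)).trans
    (OfflineRL.densityInf_inv_le_kappa hpos hH)
  obtain ⟨s₀, hs₀⟩ := M.init.support_nonempty
  obtain ⟨a₀, ha₀⟩ := (πs 0 s₀).support_nonempty
  obtain ⟨w, hw⟩ := hM.transition
  have hCw : 0 ≤ Cw := (norm_nonneg _).trans (hw 0 hH).1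
  -- In dimension zero all transition probabilities would vanish.
  have hd : 1 ≤ d := by
    by_contra hd
    obtain rfl : d = 0 := by omega
    obtain ⟨s', hs'⟩ := (M.P 0 s₀ a₀).support_nonempty
    have h1 := (hw 0 hH).2 s₀ a₀ s'
    rw [Subsingleton.elim (w 0) 0, inner_zero_right, ENNReal.toReal_eq_zero_iff] at h1
    rcases h1 with h1 | h1
    · exact (PMF.mem_support_iff _ _).1 hs' h1
    · exact PMF.apply_ne_top _ _ h1
  -- Of this logarithm and the iterated one, only nonnegativity is needed.
  have hlog : 0 ≤ Real.logb 2 (M.H / M.gapMin) := by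
    refine Real.logb_nonneg one_lt_two ?_
    rw [one_le_div hgap]
    exact OfflineRL.gapMin_le_horizon ho hgap
  have hloglog : 0 ≤ Real.log (Real.logb 2 (K * μ.kappa / δ)) := by
    refine Real.log_nonneg ?_
    rw [Real.le_logb_iff_rpow_le one_lt_two (by positivity), Real.rpow_one]
    exact hKκ
  refine le_trans (ENNReal.ofReal_le_ofReal ?_)
    ((OfflineRL.ofReal_one_sub_le_measure_concentrated hpos hκ hK hδ hδ1).trans
      (MeasureTheory.OuterMeasure.mono _ fun D hD => ?_))
  · nlinarith [mul_nonneg hlog hδ.le]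
  · refine (OfflineRL.subOptMix_le_of_concentrated hpos hM hCw hH hd hκ ho hsup hgap hK hδ hδ1
      hπ hD).trans ?_
    have h1 : 0 ≤ 16 * μ.kappa / (3 * K) * Real.log (Real.logb 2 (K * μ.kappa / δ)) := by
      positivity
    linarith
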